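/- Let $d\ge 2$ and let $\mathcal T$ be a finite conforming partition of a bounded polytope into closed $d$-simplices (any two simplices meet in a common face or not at all), let $\Omega\subset\mathbb R^d$ be the interior of the union of all simplices, and assume that each $T\in\mathcal T$ has at least one vertex in $\Omega$. Let $\mathcal N$ and $\mathcal E$ be the sets of nodes and edges of $\mathcal T$. An edge $[i,j]\in\mathcal E$ is a boundary edge if $[i,j]\subset\partial\Omega$, and an interior edge otherwise; the set of interior edges is $\mathcal E^\circ$. Let $(\varphi_i)_{i\in\mathcal N}$ be the nodal basis of the continuous piecewise affine functions and let $\langle\cdot,\cdot\rangle$ be the $L^2(\Omega)$ pairing. For $[i,j]\in\mathcal E$ let $\omega_{i,j}$ be the union of all $T\in\mathcal T$ containing $[i,j]$ and put $$b_{i,j}=\frac{(2+d)!}{d!\,|\omega_{i,j}|}\,\varphi_i\varphi_j\,(j-i).$$ For each boundary edge $[i,j]$ choose a node $m=m(i,j)=m(j,i)\in\mathcal N\cap\Omega$ with $[i,m],[j,m]\in\mathcal E^\circ$. Put $\psi_{i,j}=b_{i,j}$ if $[i,j]\in\mathcal E^\circ$, and $\psi_{i,j}=b_{i,m}+b_{m,j}$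 if $[i,j]$ is a boundary edge. For $v\in L^1(\Omega;\mathbb R^d)$ define $$\Pi_2v=-\sum_{i\in\mathcal N}\ \sum_{j\in\mathcal N:\,[i,j]\in\mathcal E}\langle\varphi_i v,\nabla\varphi_j\rangle\,\psi_{j,i}.$$ For $A\subset\overline\Omega$ let $\omega_0(A)$ be the union of all $T'\in\mathcal T$ such that $A\cap T'$ contains a node, and $\omega_1(A)$ the union of all $T'\in\mathcal T$ such that $A\cap T'$ contains an edge. Such a choice of the nodes $m(i,j)$ exists, and for every such choice $\Pi_2$ is a well-defined linear operator from $L^1(\Omega;\mathbb R^d)$ to $\operatorname{span}\{\varphi_i\varphi_j(j-i):[i,j]\in\mathcal E^\circ\}$ with the following properties. 1. (Divergence) For every $v\in W^{1,1}_0(\Omega;\mathbb R^d)$ the function $\Pi_2v$ belongs to $W^{1,1}(\Omega;\mathbb R^d)$, and $\langle\operatorname{div}\Pi_2v,\varphi_k\rangle=\langle\operatorname{div}v,\varphi_k\rangle$ for all $k\in\mathcal N$. 2. (Local stability) There is a constant $C$, depending only on $d$ and on an upper bound $\kappa$ for the ratios of diameter to inradius of the simplices in $\mathcal T$, such that for all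 $v\in L^1(\Omega;\mathbb R^d)$ and all $T\in\mathcal T$ the following holds. If every point of $\partial\Omega$ has arbitrarily small neighbourhoods whose intersection with $\Omega$ is connected (as is the case when $\Omega$ is a Lipschitz polytope), then $$\|\Pi_2v\|_{L^\infty(T)}\le C\,\frac1{|\omega_0(T)|}\int_{\omega_0(T)}|v|\,dx.$$ If $T\cap\partial\Omega=\emptyset$, then (without this condition on $\partial\Omega$) $$\|\Pi_2v\|_{L^\infty(T)}\le C\,\frac1{|\omega_1(T)|}\int_{\omega_1(T)}|v|\,dx.$$ -/

import Mathlib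

open MeasureTheory Set Filter
open scoped Topology ContDiff ENNReal Nat

noncomputable section

namespace Fortin

/-- Euclidean space `ℝᵈ`. -/
abbrev Rd (d : ℕ) := EuclideanSpace ℝ (Fin d)

/-! ### Sobolev spaces on an open set -/

/-- `η` is a smooth function with compact support in `Ω`. -/
def IsTestFunction {d : ℕ} {F : Type*} [NormedAddCommGroup F] [NormedSpace ℝ F]
    (Ω : Set (Rd d)) (η : Rd d → F) : Prop :=
  ContDiff ℝ ∞ η ∧ HasCompactSupport η ∧ tsupport η ⊆ Ω

/-- `v ∈ W^{1,1}(Ω; ℝᵈ)`, with weak gradient `G`. -/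
structure MemW11 {d : ℕ} (Ω : Set (Rd d)) (v : Rd d → Rd d)
    (G : Rd d → Rd d →L[ℝ] Rd d) : Prop where
  integrable : IntegrableOn v Ω
  integrable_grad : IntegrableOn G Ω
  weak : ∀ η : Rd d → ℝ, IsTestFunction Ω η → ∀ e : Rd d,
    ∫ x in Ω, (fderiv ℝ η x e) • v x = - ∫ x in Ω, η x • G x e

/-- `v ∈ W^{1,1}_0(Ω; ℝᵈ)`, with weak gradient `G`: the `W^{1,1}`-closure of the test fields. -/
structure MemW110 {d : ℕ} (Ω : Set (Rd d)) (v : Rd d → Rd d)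
    (G : Rd d → Rd d →L[ℝ] Rd d) : Prop extends MemW11 Ω v G where
  approx : ∃ u : ℕ → Rd d → Rd d, (∀ n, IsTestFunction Ω (u n)) ∧
    Tendsto (fun n => ∫ x in Ω, ‖u n x - v x‖) atTop (𝓝 0) ∧
    Tendsto (fun n => ∫ x in Ω, ‖fderiv ℝ (u n) x - G x‖) atTop (𝓝 0)

/-- The divergence of a field with gradient `G`, i.e. the trace of `G`. -/
def divOf {d : ℕ} (G : Rd d → Rd d →L[ℝ] Rd d) (x : Rd d) : ℝ :=
  ∑ a : Fin d, G x (EuclideanSpace.single a 1) a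

/-! ### Meshes -/

/-- A regular (conforming) partition into `d`-simplices: a finite geometric simplicial complex in
`ℝᵈ` each of whose faces is a face of a `d`-simplex. -/
structure Mesh (d : ℕ) where
  complex : Geometry.SimplicialComplex ℝ (Rd d)
  finite : complex.faces.Finite
  pure : ∀ s ∈ complex.faces, ∃ t ∈ complex.faces, s ⊆ t ∧ t.card = d + 1

namespace Mesh

variable {d : ℕ} (M : Mesh d)

theorem finite_vertices : M.complex.vertices.Finite :=
  M.finite.preimage (f := fun x : Rd d => ({x} : Finset (Rd d)))
    (Finset.singleton_injective.injOn)

/-- The set of nodes. -/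
def nodes : Finset (Rd d) := M.finite_vertices.toFinset

/-- The `d`-simplices, each represented by its set of vertices. -/
def simplices : Set (Finset (Rd d)) := {T ∈ M.complex.faces | T.card = d + 1}

/-- The closed simplex spanned by a set of vertices. -/
def hull (T : Finset (Rd d)) : Set (Rd d) := convexHull ℝ (T : Set (Rd d))

/-- The open polytope that is partitioned by the mesh. -/
def domain : Set (Rd d) := interior M.complex.space

/-- `[i, j]` is an edge. -/
def IsEdge (i j : Rd d) : Prop :=
  open Classical in i ≠ j ∧ ({i, j} : Finset (Rd d)) ∈ M.complex.faces

/-- `[i, j]` is an edge on the boundary. -/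
def IsBoundaryEdge (i j : Rd d) : Prop :=
  M.IsEdge i j ∧ segment ℝ i j ⊆ frontier M.domain

/-- `[i, j]` is an interior edge. -/
def IsInteriorEdge (i j : Rd d) : Prop :=
  M.IsEdge i j ∧ ¬ segment ℝ i j ⊆ frontier M.domain

/-- Each `d`-simplex has at least one interior node. -/
def HasInteriorNodes : Prop := ∀ T ∈ M.simplices, ∃ i ∈ T, i ∈ M.domain

/-- Shape regularity: the ratio of the diameter of each simplex to its inradius is at most `κ`. -/
def ShapeRegular (κ : ℝ) : Prop :=
  ∀ T ∈ M.simplices, ∃ x : Rd d, ∃ r : ℝ, 0 < r ∧ Metric.closedBall x r ⊆ hull T ∧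
    Metric.diam (hull T) ≤ κ * r

/-- The polytope does not touch itself: every boundary point has arbitrarily small neighbourhoods
whose intersection with the polytope is connected. Every Lipschitz polytope has this property. -/
def BoundaryLocallyConnected : Prop :=
  ∀ x ∈ frontier M.domain, ∀ U ∈ 𝓝 x, ∃ V ∈ 𝓝 x, V ⊆ U ∧ IsPreconnected (V ∩ M.domain)

/-- `w` is the family of barycentric coordinates of `x` in a simplex of the mesh containing `x`,
extended by zero to all other points. For `x` in the closed polytope there is exactly one such `w`,
as simplices of the mesh intersect in common faces. -/
def IsBarycentric (x : Rd d) (w : Rd d → ℝ) : Prop :=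
  ∃ T ∈ M.simplices, (∀ y ∈ T, 0 ≤ w y) ∧ (∀ y ∉ T, w y = 0) ∧
    ∑ y ∈ T, w y = 1 ∧ ∑ y ∈ T, w y • y = x

open Classical in
/-- The nodal basis function `φ_i` of the continuous piecewise affine functions (extended by zero
outside of the closed polytope). -/
def phi (i x : Rd d) : ℝ :=
  if h : ∃ w, M.IsBarycentric x w then h.choose i else 0

/-- The nodal patch `ω₀(A)` of a set `A`. -/
def omega0 (A : Set (Rd d)) : Set (Rd d) :=
  ⋃ T ∈ {T ∈ M.simplices | ∃ j ∈ M.nodes, j ∈ A ∩ hull T}, hull T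

/-- The edge patch `ω₁(A)` of a set `A`. -/
def omega1 (A : Set (Rd d)) : Set (Rd d) :=
  ⋃ T ∈ {T ∈ M.simplices | ∃ i j, M.IsEdge i j ∧ segment ℝ i j ⊆ A ∩ hull T}, hull T

/-- The closed patch `ω_{i,j}` of an edge: the union of all simplices with that edge. -/
def edgePatch (i j : Rd d) : Set (Rd d) :=
  ⋃ T ∈ {T ∈ M.simplices | i ∈ T ∧ j ∈ T}, hull T

/-! ### Tangential edge bubbles and the operator `Π₂` -/

/-- The tangential bubble function `φ_i φ_j (j - i)`. -/
def bubble (i j : Rd d) : Rd d → Rd d := fun x => (M.phi i x * M.phi j x) • (j - i)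

/-- The span of the interior tangential bubble functions. -/
def edgeSpace : Submodule ℝ (Rd d → Rd d) :=
  Submodule.span ℝ {f | ∃ i j, M.IsInteriorEdge i j ∧ f = M.bubble i j}

/-- The normalized tangential bubble function `b_{i,j}`. -/
def b (i j : Rd d) : Rd d → Rd d :=
  (((2 + d)! : ℝ) / ((d ! : ℝ) * volume.real (M.edgePatch i j))) • M.bubble i j

/-- `m` chooses, for each (undirected) boundary edge `[i, j]`, an interior node `m i j` such that
`[i, m i j]` and `[j, m i j]` are interior edges. -/
def IsChoice (m : Rd d → Rd d → Rd d) : Prop :=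
  ∀ i j, M.IsBoundaryEdge i j → m i j = m j i ∧ m i j ∈ M.nodes ∧ m i j ∈ M.domain ∧
    M.IsInteriorEdge i (m i j) ∧ M.IsInteriorEdge j (m i j)

open Classical in
/-- The modified tangential bubble function `ψ_{i,j}`. -/
def psi (m : Rd d → Rd d → Rd d) (i j : Rd d) : Rd d → Rd d :=
  if M.IsBoundaryEdge i j then M.b i (m i j) + M.b (m i j) j else M.b i j

open Classical in
/-- The operator `Π_{2,i} v = - ∑_j ⟨φ_i v, ∇φ_j⟩ ψ_{j,i}`, the sum being over all `j` such that
`[i, j]` is an edge. The gradient of `φ_j` is the classical one, which exists in the interior of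
each simplex. -/
def Pi2Node (m : Rd d → Rd d → Rd d) (i : Rd d) (v : Rd d → Rd d) : Rd d → Rd d :=
  - ∑ j ∈ M.nodes with M.IsEdge i j,
    (∫ x in M.domain, inner ℝ (M.phi i x • v x) (gradient (M.phi j) x)) • M.psi m j i

/-- The divergence correcting operator `Π₂ = ∑_i Π_{2,i}`. -/
def Pi2 (m : Rd d → Rd d → Rd d) (v : Rd d → Rd d) : Rd d → Rd d :=
  ∑ i ∈ M.nodes, M.Pi2Node m i v

end Mesh

end Fortin

end

/-!
Exchanging two vertices of a simplex and bisecting its edge between them give the averages of the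
products of barycentric coordinates. Hence the divergence of `b_{i,j}` has moment `1` against `φ_i`,
`-1` against `φ_j` and `0` against all other nodal basis functions. By telescoping through the node
`m`, the same holds for `ψ_{i,j}`. As `∑_i φ_i = 1` and `∑_j ∇φ_j = 0`, the coefficients satisfy
`∑_i ⟨φ_i v, ∇φ_k⟩ = ⟨v, ∇φ_k⟩ = -⟨div v, φ_k⟩` and `∑_j ⟨φ_k v, ∇φ_j⟩ = 0`, so that `Π₂ v` has the
divergence moments of `v`.

For the stability, `|∇φ_j| ≤ κ / |j - i|` on a simplex with the edge `[i, j]`, so that each summand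
of `Π₂ v` is bounded on `T` by the integral of `|v|` over `ω_{i,j}`, divided by `|T|`. The number of
summands is bounded because the simplices at a vertex fill a fixed fraction of a ball around it.
Simplices that share an edge have comparable diameters. If `Ω` does not touch itself at a vertex, a
small connected subset of `Ω` without this vertex meets all simplices at it, so that any two of them
are linked by a chain in which neighbours share an edge; hence their diameters are comparable, too.
-/

noncomputable section

namespace Fortin

open Mesh
open scoped NNReal

section AffineBasis

variable {E ι : Type*} [AddCommGroup E] [Module ℝ E] (b : AffineBasis ι ℝ E) {i j : ι}

theorem coord_add_smul_sub [DecidableEq ι] (i j k : ι) (t : ℝ) (x : E) :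
    b.coord k (x + t • (b j - b i)) =
      b.coord k x + t * ((if k = j then 1 else 0) - if k = i then 1 else 0) := by
  have hlin : (b.coord k).linear (b j - b i) = b.coord k (b j) - b.coord k (b i) := by
    simpa only [vsub_eq_sub] using (b.coord k).linearMap_vsub (b j) (b i)
  rw [add_comm, ← vadd_eq_add, AffineMap.map_vadd, map_smul, hlin, b.coord_apply, b.coord_apply,
    smul_eq_mul, vadd_eq_add, add_comm]

/-- The affine map `x ↦ x + f x • w`, the common form of the maps that exchange two vertices of a
simplex or bisect it through the midpoint of an edge. -/
def shear (f : E →ᵃ[ℝ] ℝ) (w : E) : E →ᵃ[ℝ] E :=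
  AffineMap.id ℝ E + (LinearMap.toSpanSingleton ℝ E w).toAffineMap.comp f

theorem shear_apply (f : E →ᵃ[ℝ] ℝ) (w x : E) : shear f w x = x + f x • w := rfl

/-- The affine involution that exchanges the vertices `i` and `j` and fixes the other vertices. -/
def vertexSwap (i j : ι) : E →ᵃ[ℝ] E := shear (b.coord i - b.coord j) (b j - b i)

theorem coord_vertexSwap [DecidableEq ι] (i j k : ι) (x : E) :
    b.coord k (vertexSwap b i j x) = b.coord (Equiv.swap i j k) x := by
  rw [vertexSwap, shear_apply, coord_add_smul_sub, AffineMap.coe_sub, Pi.sub_apply,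
    Equiv.swap_apply_def]
  split_ifs <;> subst_vars <;> simp

theorem vertexSwap_involutive [Finite ι] (i j : ι) : Function.Involutive (vertexSwap b i j) := by
  classical
  exact fun x => b.ext_elem fun k => by simp only [coord_vertexSwap, Equiv.swap_apply_self]

theorem vertexSwap_mem_simplex_iff {x : E} :
    vertexSwap b i j x ∈ convexHull ℝ (range b) ↔ x ∈ convexHull ℝ (range b) := by
  classical
  simp only [b.convexHull_eq_nonneg_coord, mem_ofPred_eq, coord_vertexSwap]
  exact (Equiv.swap i j).forall_congr_left.trans
    (by simp only [Equiv.symm_swap, Equiv.swap_apply_self])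

theorem vertexSwap_image_simplex [Finite ι] :
    vertexSwap b i j '' convexHull ℝ (range b) = convexHull ℝ (range b) := by
  rw [(vertexSwap_involutive b i j).image_eq_preimage_symm]
  exact ext fun x => vertexSwap_mem_simplex_iff b

/-- The part of the simplex that is closer to the vertex `i` than to the vertex `j`, in
barycentric coordinates. -/
def halfSimplex (i j : ι) : Set E := {x ∈ convexHull ℝ (range b) | b.coord j x ≤ b.coord i x}

theorem halfSimplex_union_halfSimplex :
    halfSimplex b i j ∪ halfSimplex b j i = convexHull ℝ (range b) := by
  rw [halfSimplex, halfSimplex, ← ofPred_or]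
  ext x
  simp only [mem_ofPred_eq, ← and_or_left, and_iff_left (le_total (b.coord j x) (b.coord i x))]

theorem vertexSwap_image_halfSimplex [Finite ι] :
    vertexSwap b i j '' halfSimplex b i j = halfSimplex b j i := by
  classical
  rw [(vertexSwap_involutive b i j).image_eq_preimage_symm]
  ext x
  rw [mem_preimage, halfSimplex, halfSimplex, mem_ofPred_eq, mem_ofPred_eq,
    vertexSwap_mem_simplex_iff, coord_vertexSwap, coord_vertexSwap, Equiv.swap_apply_left,
    Equiv.swap_apply_right]

/-- The affine map that sends the vertex `j` to the midpoint of the edge from `i` to `j` and fixes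
the other vertices. -/
def bisection (i j : ι) : E →ᵃ[ℝ] E := shear ((2⁻¹ : ℝ) • b.coord j) (b i - b j)

theorem coord_bisection [DecidableEq ι] (i j k : ι) (x : E) :
    b.coord k (bisection b i j x) =
      b.coord k x + b.coord j x / 2 * ((if k = i then 1 else 0) - if k = j then 1 else 0) := by
  rw [bisection, shear_apply, coord_add_smul_sub, AffineMap.coe_smul, Pi.smul_apply, smul_eq_mul,
    inv_mul_eq_div]

theorem coord_bisection_left (hij : i ≠ j) (x : E) :
    b.coord i (bisection b i j x) = b.coord i x + b.coord j x / 2 := by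
  classical simp [coord_bisection, hij]

theorem coord_bisection_right (hij : i ≠ j) (x : E) :
    b.coord j (bisection b i j x) = b.coord j x / 2 := by
  classical
  rw [coord_bisection, if_neg hij.symm, if_pos rfl]
  ring

theorem bisection_injective (hij : i ≠ j) : Function.Injective (bisection b i j) := by
  intro x y hxy
  have hcoord : b.coord j x = b.coord j y := by
    have h := congrArg (b.coord j) hxy
    rw [coord_bisection_right b hij, coord_bisection_right b hij] at h
    linarith
  rw [bisection, shear_apply, shear_apply, AffineMap.coe_smul, Pi.smul_apply, Pi.smul_apply,
    hcoord] at hxy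
  exact add_right_cancel hxy

theorem bisection_image_simplex [Finite ι] (hij : i ≠ j) :
    bisection b i j '' convexHull ℝ (range b) = halfSimplex b i j := by
  classical
  rw [halfSimplex, b.convexHull_eq_nonneg_coord]
  refine Subset.antisymm ?_ fun y ⟨hy, hle⟩ => ?_
  · rintro _ ⟨x, hx, rfl⟩
    refine ⟨fun k => ?_, ?_⟩
    · by_cases hkj : k = j
      · rw [hkj, coord_bisection_right b hij]
        exact div_nonneg (hx j) zero_le_two
      · rw [coord_bisection, if_neg hkj, sub_zero]
        refine add_nonneg (hx k) (mul_nonneg (div_nonneg (hx j) zero_le_two) ?_)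
        split_ifs <;> norm_num
    · rw [coord_bisection_left b hij, coord_bisection_right b hij]
      exact le_add_of_nonneg_left (hx i)
  · have hcoord (k : ι) := coord_add_smul_sub b j i k (-b.coord j y) y
    refine ⟨y + -b.coord j y • (b i - b j), fun k => ?_, b.ext_elem fun k => ?_⟩
    · rw [hcoord]
      have hk := hy k
      have hj := hy j
      split_ifs with hki hkj hkj <;> subst_vars <;> linarith
    · rw [coord_bisection, hcoord, hcoord, if_neg hij.symm, if_pos rfl]
      ring

end AffineBasis

section Topology

variable {E ι : Type*} [Finite ι] [NormedAddCommGroup E] [NormedSpace ℝ E]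

theorem isCompact_convexHull_range (p : ι → E) : IsCompact (convexHull ℝ (range p)) :=
  (finite_range p).isCompact_convexHull (𝕜 := ℝ)

variable [FiniteDimensional ℝ E] (b : AffineBasis ι ℝ E) {i j : ι}

theorem isCompact_halfSimplex : IsCompact (halfSimplex b i j) :=
  (isCompact_convexHull_range b).inter_right
    (isClosed_le (continuous_barycentric_coord b j) (continuous_barycentric_coord b i))

end Topology

section Average

variable {E F ι : Type*} [NormedAddCommGroup E] [NormedSpace ℝ E] [FiniteDimensional ℝ E]
  [MeasurableSpace E] [BorelSpace E] (μ : Measure E) [μ.IsAddHaarMeasure]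
  [NormedAddCommGroup F] [NormedSpace ℝ F]

theorem setIntegral_image_affineMap {f : E →ᵃ[ℝ] E} (hf : Function.Injective f) {s : Set E}
    (hs : MeasurableSet s) (g : E → F) :
    ∫ x in f '' s, g x ∂μ = |f.linear.det| • ∫ x in s, g (f x) ∂μ := by
  have hderiv : ∀ x ∈ s, HasFDerivWithinAt f f.linear.toContinuousLinearMap s x := fun x _ =>
    (ContinuousAffineMap.hasFDerivAt ⟨f, f.continuous_of_finiteDimensional⟩).hasFDerivWithinAt
  rw [integral_image_eq_integral_abs_det_fderiv_smul μ hs hderiv hf.injOn, integral_smul,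
    LinearMap.det_toContinuousLinearMap]

theorem setAverage_image_affineMap {f : E →ᵃ[ℝ] E} (hf : Function.Injective f) {s : Set E}
    (hs : MeasurableSet s) (g : E → F) :
    ⨍ x in f '' s, g x ∂μ = ⨍ x in s, g (f x) ∂μ := by
  have hvol : μ.real (f '' s) = |f.linear.det| * μ.real s := by
    simpa using setIntegral_image_affineMap μ hf hs fun _ => (1 : ℝ)
  have hdet : |f.linear.det| ≠ 0 := by
    have hunit := (LinearEquiv.ofInjectiveEndo f.linear (f.linear_injective_iff.2 hf)).isUnit_det'
    exact abs_ne_zero.2 hunit.ne_zero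
  rw [setAverage_eq, setAverage_eq, setIntegral_image_affineMap μ hf hs, hvol, smul_smul,
    mul_inv_rev, inv_mul_cancel_right₀ hdet]

theorem addHaar_affineMap_eq_zero {f : E →ᵃ[ℝ] ℝ} {p : E} (hp : f p ≠ 0) :
    μ {x | f x = 0} = 0 := by
  have hmem (x : E) :
      x ∈ (AffineSubspace.mk' (0 : ℝ) (⊥ : Submodule ℝ ℝ)).comap f ↔ f x = 0 := by
    simp [AffineSubspace.mem_mk']
  have hne : (AffineSubspace.mk' (0 : ℝ) (⊥ : Submodule ℝ ℝ)).comap f ≠ ⊤ := fun htop =>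
    hp ((hmem p).1 (htop ▸ AffineSubspace.mem_top ℝ E p))
  simpa only [← hmem] using! Measure.addHaar_affineSubspace μ _ hne

variable (b : AffineBasis ι ℝ E) {i j : ι}

theorem aedisjoint_halfSimplex (hij : i ≠ j) :
    AEDisjoint μ (halfSimplex b i j) (halfSimplex b j i) := by
  refine measure_mono_null (fun x hx => ?_)
    (addHaar_affineMap_eq_zero μ (f := b.coord i - b.coord j) (p := b i) (by simp [hij.symm]))
  exact sub_eq_zero.2 (le_antisymm hx.2.2 hx.1.2)

variable [Finite ι]

theorem setAverage_simplex_eq_halfSimplex (hij : i ≠ j) {g : E → ℝ} (hg : Continuous g)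
    (hswap : ∀ x, g (vertexSwap b i j x) = g x) :
    ⨍ x in convexHull ℝ (range b), g x ∂μ = ⨍ x in halfSimplex b i j, g x ∂μ := by
  have hcompact (k l : ι) : IsCompact (halfSimplex b k l) := isCompact_halfSimplex b
  have hsymm : ⨍ x in halfSimplex b j i, g x ∂μ = ⨍ x in halfSimplex b i j, g x ∂μ := by
    rw [← vertexSwap_image_halfSimplex, setAverage_image_affineMap μ
      (vertexSwap_involutive b i j).injective (hcompact _ _).measurableSet]
    simp only [hswap]
  have hmem := average_union_mem_segment (aedisjoint_halfSimplex μ b hij)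
    (hcompact _ _).measurableSet.nullMeasurableSet (hcompact i j).measure_ne_top
    (hcompact j i).measure_ne_top (hg.continuousOn.integrableOn_compact (hcompact i j))
    (hg.continuousOn.integrableOn_compact (hcompact j i))
  rwa [hsymm, segment_same, halfSimplex_union_halfSimplex, mem_singleton_iff] at hmem

theorem setAverage_coord_sq_congr (i j : ι) :
    ⨍ x in convexHull ℝ (range b), b.coord i x ^ 2 ∂μ =
      ⨍ x in convexHull ℝ (range b), b.coord j x ^ 2 ∂μ := by
  classical
  have himage := setAverage_image_affineMap μ (vertexSwap_involutive b i j).injective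
    (isCompact_convexHull_range b).measurableSet fun x => b.coord i x ^ 2
  simpa only [vertexSwap_image_simplex, coord_vertexSwap, Equiv.swap_apply_left] using himage

theorem setAverage_coord_sub_coord_sq (hij : i ≠ j) :
    ⨍ x in convexHull ℝ (range b), (b.coord i x - b.coord j x) ^ 2 ∂μ =
      ⨍ x in convexHull ℝ (range b), b.coord i x ^ 2 ∂μ := by
  classical
  have hcont (k : ι) : Continuous (b.coord k) := continuous_barycentric_coord b k
  have hsymm (x : E) : (b.coord i (vertexSwap b i j x) - b.coord j (vertexSwap b i j x)) ^ 2 =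
      (b.coord i x - b.coord j x) ^ 2 := by
    rw [coord_vertexSwap, coord_vertexSwap, Equiv.swap_apply_left, Equiv.swap_apply_right,
      sub_sq_comm]
  rw [setAverage_simplex_eq_halfSimplex μ b hij (by fun_prop) hsymm,
    ← bisection_image_simplex b hij, setAverage_image_affineMap μ (bisection_injective b hij)
      (isCompact_convexHull_range b).measurableSet]
  simp only [coord_bisection_left b hij, coord_bisection_right b hij, add_sub_cancel_right]

theorem setAverage_coord_sq_eq_two_mul (hij : i ≠ j) :
    ⨍ x in convexHull ℝ (range b), b.coord i x ^ 2 ∂μ =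
      2 * ⨍ x in convexHull ℝ (range b), b.coord i x * b.coord j x ∂μ := by
  have hcont (k : ι) : Continuous (b.coord k) := continuous_barycentric_coord b k
  have hint {g : E → ℝ} (hg : Continuous g) :=
    (hg.continuousOn.integrableOn_compact (μ := μ) (isCompact_convexHull_range b)).to_average
  have hexpand := setAverage_coord_sub_coord_sq μ b hij
  have hcongr := setAverage_coord_sq_congr μ b i j
  simp only [average, sub_sq, mul_assoc] at hexpand hcongr ⊢
  rw [integral_add (hint (by fun_prop)) (hint (by fun_prop)),
    integral_sub (hint (by fun_prop)) (hint (by fun_prop)), integral_const_mul] at hexpand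
  linarith

end Average

theorem setAverage_coord_mul_coord {E ι : Type*} [NormedAddCommGroup E] [NormedSpace ℝ E]
    [FiniteDimensional ℝ E] [MeasurableSpace E] [BorelSpace E] (μ : Measure E)
    [μ.IsAddHaarMeasure] (b : AffineBasis ι ℝ E) [Fintype ι] [DecidableEq ι] (i j : ι) :
    ⨍ x in convexHull ℝ (range b), b.coord i x * b.coord j x ∂μ =
      (1 + if i = j then 1 else 0) / (Fintype.card ι * (Fintype.card ι + 1)) := by
  set S := convexHull ℝ (range b)
  have hcont (k : ι) : Continuous (b.coord k) := continuous_barycentric_coord b k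
  have hint {g : E → ℝ} (hg : Continuous g) :=
    (hg.continuousOn.integrableOn_compact (μ := μ) (isCompact_convexHull_range b)).to_average
  set A := ⨍ x in S, b.coord i x ^ 2 ∂μ
  have hmoment (k l : ι) :
      ⨍ x in S, b.coord k x * b.coord l x ∂μ = A / 2 * (1 + if k = l then 1 else 0) := by
    have hk : ⨍ x in S, b.coord k x ^ 2 ∂μ = A := setAverage_coord_sq_congr μ b k i
    split_ifs with hkl
    · simp only [← hkl, ← sq, hk]
      ring
    · linarith [setAverage_coord_sq_eq_two_mul μ b hkl]
  have hpos : μ S ≠ 0 := (Measure.measure_pos_of_nonempty_interior μ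
    ⟨_, b.centroid_mem_interior_convexHull⟩).ne'
  have hsum : (1 : ℝ) = ∑ k, ∑ l, A / 2 * (1 + if k = l then 1 else 0) := calc
    (1 : ℝ) = ⨍ x in S, ∑ k, ∑ l, b.coord k x * b.coord l x ∂μ := by
      simp only [← Finset.mul_sum, b.sum_coord_apply_eq_one, mul_one]
      exact (setAverage_const hpos (isCompact_convexHull_range b).measure_ne_top 1).symm
    _ = ∑ k, ∑ l, ⨍ x in S, b.coord k x * b.coord l x ∂μ := by
      simp only [average]
      rw [integral_finsetSum _ fun k _ => hint (by fun_prop)]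
      exact Finset.sum_congr rfl fun k _ => integral_finsetSum _ fun l _ => hint (by fun_prop)
    _ = ∑ k, ∑ l, A / 2 * (1 + if k = l then 1 else 0) :=
      Finset.sum_congr rfl fun k _ => Finset.sum_congr rfl fun l _ => hmoment k l
  simp only [← Finset.mul_sum, Finset.sum_add_distrib, Finset.sum_ite_eq, Finset.mem_univ,
    if_true, Finset.sum_const, Finset.card_univ, nsmul_eq_mul, mul_one] at hsum
  have hcard : (0 : ℝ) < Fintype.card ι := Nat.cast_pos.2 (Fintype.card_pos_iff.2 ⟨i⟩)
  rw [hmoment, eq_div_iff (by positivity)]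
  linear_combination (-(1 + if i = j then 1 else 0)) * hsum

section Simplex

variable {d : ℕ}

/-- `T` is the vertex set of a non-degenerate `d`-simplex in `ℝᵈ`. -/
structure IsSimplex (T : Finset (Rd d)) : Prop where
  affineIndependent : AffineIndependent ℝ ((↑) : T → Rd d)
  card : T.card = d + 1

theorem IsSimplex.affineSpan_eq_top {T : Finset (Rd d)} (hT : IsSimplex T) :
    affineSpan ℝ (range ((↑) : T → Rd d)) = ⊤ := by
  rw [hT.affineIndependent.affineSpan_eq_top_iff_card_eq_finrank_add_one, Fintype.card_coe, hT.card,
    finrank_euclideanSpace_fin]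

/-- The affine basis of `ℝᵈ` given by the vertices of a simplex. -/
def IsSimplex.basis {T : Finset (Rd d)} (hT : IsSimplex T) : AffineBasis T ℝ (Rd d) :=
  ⟨(↑), hT.affineIndependent, hT.affineSpan_eq_top⟩

open Classical in
/-- The barycentric coordinate of the vertex `k` in the simplex `T`, as an affine function on the
whole space. It is zero if `k` is not a vertex. -/
def bary (T : Finset (Rd d)) (k : Rd d) : Rd d →ᴬ[ℝ] ℝ :=
  if h : IsSimplex T ∧ k ∈ T then
    ⟨h.1.basis.coord ⟨k, h.2⟩, continuous_barycentric_coord _ _⟩ else 0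

/-- The constant gradient of a barycentric coordinate, as a linear functional. -/
def baryGrad (T : Finset (Rd d)) (k : Rd d) : Rd d →L[ℝ] ℝ := (bary T k).contLinear

theorem hasFDerivAt_bary (T : Finset (Rd d)) (k x : Rd d) :
    HasFDerivAt (bary T k) (baryGrad T k) x := (bary T k).hasFDerivAt

theorem bary_of_notMem {T : Finset (Rd d)} {k : Rd d} (hk : k ∉ T) : bary T k = 0 :=
  dif_neg fun h => hk h.2

theorem bary_sub_bary (T : Finset (Rd d)) (k x y : Rd d) :
    bary T k x - bary T k y = baryGrad T k (x - y) :=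
  ((bary T k).linearMap_vsub x y).symm

theorem convex_hull (T : Finset (Rd d)) : Convex ℝ (hull T) := convex_convexHull ℝ _

theorem isCompact_hull (T : Finset (Rd d)) : IsCompact (hull T) :=
  T.finite_toSet.isCompact_convexHull (𝕜 := ℝ)

theorem isClosed_hull (T : Finset (Rd d)) : IsClosed (hull T) := (isCompact_hull T).isClosed

theorem mem_hull {T : Finset (Rd d)} {k : Rd d} (hk : k ∈ T) : k ∈ hull T :=
  subset_convexHull ℝ _ hk

theorem volume_frontier_hull (T : Finset (Rd d)) : volume (frontier (hull T)) = 0 :=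
  (convex_hull T).addHaar_frontier volume

namespace IsSimplex

variable {T : Finset (Rd d)} (hT : IsSimplex T)
include hT

theorem range_basis : range hT.basis = T := Subtype.range_coe

theorem bary_eq_coord {k : Rd d} (hk : k ∈ T) (x : Rd d) :
    bary T k x = hT.basis.coord ⟨k, hk⟩ x := by
  rw [bary, dif_pos ⟨hT, hk⟩]
  rfl

theorem bary_apply_vertex [DecidableEq (Rd d)] (k : Rd d) {l : Rd d} (hl : l ∈ T) :
    bary T k l = if k = l then 1 else 0 := by
  by_cases hk : k ∈ T
  · rw [hT.bary_eq_coord hk]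
    exact (hT.basis.coord_apply ⟨k, hk⟩ ⟨l, hl⟩).trans (if_congr Subtype.mk_eq_mk rfl rfl)
  · rw [bary_of_notMem hk, if_neg (ne_of_mem_of_not_mem hl hk).symm]
    rfl

theorem bary_self {k : Rd d} (hk : k ∈ T) : bary T k k = 1 := by
  classical rw [hT.bary_apply_vertex k hk, if_pos rfl]

theorem bary_ne {k l : Rd d} (hl : l ∈ T) (hkl : k ≠ l) : bary T k l = 0 := by
  classical rw [hT.bary_apply_vertex k hl, if_neg hkl]

theorem baryGrad_sub [DecidableEq (Rd d)] {i j : Rd d} (hi : i ∈ T) (hj : j ∈ T) (k : Rd d) :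
    baryGrad T k (j - i) = (if k = j then 1 else 0) - if k = i then 1 else 0 := by
  rw [← bary_sub_bary, hT.bary_apply_vertex k hi, hT.bary_apply_vertex k hj]

theorem sum_bary (x : Rd d) : ∑ k ∈ T, bary T k x = 1 := by
  rw [← hT.basis.sum_coord_apply_eq_one x, ← Finset.sum_coe_sort]
  exact Finset.sum_congr rfl fun k _ => hT.bary_eq_coord k.2 x

theorem sum_bary_smul (x : Rd d) : ∑ k ∈ T, bary T k x • k = x := by
  conv_rhs => rw [← hT.basis.linear_combination_coord_eq_self x]
  rw [← Finset.sum_coe_sort]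
  exact Finset.sum_congr rfl fun k _ => congrArg (· • (k : Rd d)) (hT.bary_eq_coord k.2 x)

theorem eq_bary {w : Rd d → ℝ} {x : Rd d} (hsum : ∑ y ∈ T, w y = 1)
    (hcomb : ∑ y ∈ T, w y • y = x) {k : Rd d} (hk : k ∈ T) : w k = bary T k x := by
  have hmap := Finset.map_affineCombination T id w hsum (bary T k : Rd d →ᵃ[ℝ] ℝ)
  rw [T.affineCombination_eq_linear_combination _ _ hsum,
    T.affineCombination_eq_linear_combination _ _ hsum] at hmap
  simp only [id_eq, hcomb, Function.comp_apply, smul_eq_mul] at hmap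
  rw [show bary T k x = _ from hmap, Finset.sum_eq_single_of_mem k hk fun l hl hlk => ?_]
  · exact (mul_one (w k)).symm.trans (congrArg (w k * ·) (hT.bary_self hk).symm)
  · exact mul_eq_zero_of_right _ (hT.bary_ne hl hlk.symm)

theorem mem_hull_iff {x : Rd d} : x ∈ hull T ↔ ∀ k ∈ T, 0 ≤ bary T k x := by
  rw [hull, ← hT.range_basis, hT.basis.convexHull_eq_nonneg_coord]
  exact Subtype.forall.trans (forall₂_congr fun k hk => by rw [hT.bary_eq_coord hk])

theorem bary_nonneg {x : Rd d} (hx : x ∈ hull T) (k : Rd d) : 0 ≤ bary T k x := by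
  by_cases hk : k ∈ T
  · exact hT.mem_hull_iff.1 hx k hk
  · exact (DFunLike.congr_fun (bary_of_notMem hk) x).ge

theorem bary_le_one {x : Rd d} (hx : x ∈ hull T) (k : Rd d) : bary T k x ≤ 1 := by
  by_cases hk : k ∈ T
  · rw [← hT.sum_bary x]
    exact Finset.single_le_sum (fun l _ => hT.bary_nonneg hx l) hk
  · exact (DFunLike.congr_fun (bary_of_notMem hk) x).trans_le zero_le_one

theorem interior_hull_nonempty : (interior (hull T)).Nonempty := by
  rw [hull, interior_convexHull_nonempty_iff_affineSpan_eq_top, ← hT.range_basis]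
  exact hT.basis.tot

theorem volume_hull_pos : 0 < volume.real (hull T) :=
  ENNReal.toReal_pos ((Measure.measure_pos_of_nonempty_interior _ hT.interior_hull_nonempty).ne')
    (isCompact_hull T).measure_ne_top

theorem integral_bary_mul_bary [DecidableEq (Rd d)] {i j : Rd d} (hi : i ∈ T) (hj : j ∈ T) :
    ∫ x in hull T, bary T i x * bary T j x =
      volume.real (hull T) * ((1 + if i = j then 1 else 0) / ((d + 1) * (d + 2))) := by
  have hmoment := setAverage_coord_mul_coord volume hT.basis ⟨i, hi⟩ ⟨j, hj⟩
  rw [hT.range_basis, Fintype.card_coe, hT.card] at hmoment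
  rw [← measure_smul_setAverage _ (isCompact_hull T).measure_ne_top, smul_eq_mul]
  simp only [hT.bary_eq_coord hi, hT.bary_eq_coord hj, hull, hmoment, Subtype.mk.injEq]
  push_cast
  ring

theorem integral_bary_sub_bary_mul [DecidableEq (Rd d)] {i j : Rd d} (hi : i ∈ T)
    (hj : j ∈ T) (k : Rd d) :
    ∫ x in hull T, (bary T i x - bary T j x) * bary T k x =
      volume.real (hull T) / ((d + 1) * (d + 2)) *
        (Pi.single i (1 : ℝ) - Pi.single j (1 : ℝ) : Rd d → ℝ) k := by
  by_cases hk : k ∈ T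
  · have hint (l : Rd d) : IntegrableOn (fun x => bary T l x * bary T k x) (hull T) :=
      ((bary T l).continuous.mul (bary T k).continuous).continuousOn.integrableOn_compact
        (isCompact_hull T)
    simp only [sub_mul]
    rw [integral_sub (hint i) (hint j), hT.integral_bary_mul_bary hi hk,
      hT.integral_bary_mul_bary hj hk, Pi.sub_apply, Pi.single_apply, Pi.single_apply]
    simp only [eq_comm (a := k)]
    ring
  · have hki : k ≠ i := fun hki => hk (hki ▸ hi)
    have hkj : k ≠ j := fun hkj => hk (hkj ▸ hj)
    simp [bary_of_notMem hk, hki, hkj]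

end IsSimplex

end Simplex

namespace Mesh

variable {d : ℕ} {M : Mesh d}

theorem isSimplex {T : Finset (Rd d)} (hT : T ∈ M.simplices) : IsSimplex T :=
  ⟨M.complex.indep hT.1, hT.2⟩

theorem finite_simplices (M : Mesh d) : M.simplices.Finite := M.finite.subset fun _ h => h.1

/-- The `d`-simplices of the mesh as a `Finset`, for sums over all simplices. -/
def elements (M : Mesh d) : Finset (Finset (Rd d)) := M.finite_simplices.toFinset

theorem mem_elements {T : Finset (Rd d)} : T ∈ M.elements ↔ T ∈ M.simplices :=
  M.finite_simplices.mem_toFinset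

theorem mem_nodes_iff {k : Rd d} : k ∈ M.nodes ↔ ∃ T ∈ M.simplices, k ∈ T := by
  rw [nodes, Set.Finite.mem_toFinset]
  constructor
  · intro hk
    obtain ⟨T, hT, hkT, hcard⟩ := M.pure _ hk
    exact ⟨T, ⟨hT, hcard⟩, hkT (Finset.mem_singleton_self k)⟩
  · rintro ⟨T, hT, hk⟩
    exact M.complex.down_closed hT.1 (Finset.singleton_subset_iff.2 hk)
      (Finset.singleton_nonempty k)

theorem mem_of_mem_hull {k : Rd d} {T : Finset (Rd d)} (hk : k ∈ M.nodes)
    (hT : T ∈ M.simplices) (h : k ∈ hull T) : k ∈ T :=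
  (Geometry.SimplicialComplex.vertex_mem_convexHull_iff
    (M.finite_vertices.mem_toFinset.1 hk) hT.1).1 h

theorem hull_subset_space {T : Finset (Rd d)} (hT : T ∈ M.simplices) :
    hull T ⊆ M.complex.space :=
  Geometry.SimplicialComplex.convexHull_subset_space hT.1

theorem exists_mem_hull {x : Rd d} (hx : x ∈ M.complex.space) :
    ∃ T ∈ M.simplices, x ∈ hull T := by
  obtain ⟨s, hs, hxs⟩ := Geometry.SimplicialComplex.mem_space_iff.1 hx
  obtain ⟨T, hT, hsT, hcard⟩ := M.pure s hs
  exact ⟨T, ⟨hT, hcard⟩, convexHull_mono (Finset.coe_subset.2 hsT) hxs⟩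

theorem space_eq_biUnion_hull : M.complex.space = ⋃ T ∈ M.elements, hull T :=
  Subset.antisymm (fun _ hx => let ⟨_, hT, hxT⟩ := exists_mem_hull hx
      mem_biUnion (mem_elements.2 hT) hxT)
    (iUnion₂_subset fun _ hT => hull_subset_space (mem_elements.1 hT))

theorem isCompact_space : IsCompact M.complex.space := by
  rw [space_eq_biUnion_hull]
  exact M.elements.isCompact_biUnion fun T _ => isCompact_hull T

theorem domain_subset_space : M.domain ⊆ M.complex.space := interior_subset

theorem isOpen_domain : IsOpen M.domain := isOpen_interior

theorem disjoint_domain_frontier : Disjoint M.domain (frontier M.domain) :=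
  (disjoint_frontier_iff_isOpen.2 isOpen_domain).symm

theorem interior_hull_subset_domain {T : Finset (Rd d)} (hT : T ∈ M.simplices) :
    interior (hull T) ⊆ M.domain :=
  interior_mono (hull_subset_space hT)

instance : IsFiniteMeasure (volume.restrict M.domain) :=
  isFiniteMeasure_restrict.2 <|
    ((measure_mono domain_subset_space).trans_lt isCompact_space.measure_lt_top).ne

section NodalBasis

variable {T T' : Finset (Rd d)}

theorem bary_eq_bary (hT : T ∈ M.simplices) (hT' : T' ∈ M.simplices) {x : Rd d}
    (hx : x ∈ hull T) (hx' : x ∈ hull T') (k : Rd d) : bary T k x = bary T' k x := by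
  classical
  have hface : x ∈ affineSpan ℝ (T ∩ T' : Set (Rd d)) :=
    convexHull_subset_affineSpan _ (M.complex.inter_subset_convexHull hT.1 hT'.1 ⟨hx, hx'⟩)
  refine AffineMap.eqOn_affineSpan (f := (bary T k : Rd d →ᵃ[ℝ] ℝ)) (g := bary T' k)
    (fun l hl => ?_) hface
  exact ((isSimplex hT).bary_apply_vertex k hl.1).trans
    ((isSimplex hT').bary_apply_vertex k hl.2).symm

theorem phi_eq_bary (hT : T ∈ M.simplices) {x : Rd d} (hx : x ∈ hull T) (k : Rd d) :
    M.phi k x = bary T k x := by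
  have hex : ∃ w, M.IsBarycentric x w :=
    ⟨fun y => bary T y x, T, hT, fun y _ => (isSimplex hT).bary_nonneg hx y,
      fun y hy => DFunLike.congr_fun (bary_of_notMem hy) x, (isSimplex hT).sum_bary x,
      (isSimplex hT).sum_bary_smul x⟩
  rw [phi, dif_pos hex]
  obtain ⟨T', hT', hnonneg, hzero, hsum, hcomb⟩ := hex.choose_spec
  have hx' : x ∈ hull T' := Finset.mem_convexHull'.2 ⟨_, hnonneg, hsum, hcomb⟩
  rw [bary_eq_bary hT hT' hx hx']
  by_cases hk : k ∈ T'
  · exact (isSimplex hT').eq_bary hsum hcomb hk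
  · rw [hzero k hk, bary_of_notMem hk]
    rfl

theorem abs_phi_le_one {x : Rd d} (hx : x ∈ M.complex.space) (k : Rd d) : |M.phi k x| ≤ 1 := by
  obtain ⟨T, hT, hxT⟩ := exists_mem_hull hx
  rw [phi_eq_bary hT hxT, abs_of_nonneg ((isSimplex hT).bary_nonneg hxT k)]
  exact (isSimplex hT).bary_le_one hxT k

theorem sum_phi {x : Rd d} (hx : x ∈ M.complex.space) : ∑ k ∈ M.nodes, M.phi k x = 1 := by
  obtain ⟨T, hT, hxT⟩ := exists_mem_hull hx
  simp only [phi_eq_bary hT hxT]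
  rw [← (isSimplex hT).sum_bary x]
  refine (Finset.sum_subset (fun k hk => mem_nodes_iff.2 ⟨T, hT, hk⟩) fun k _ hk => ?_).symm
  exact DFunLike.congr_fun (bary_of_notMem hk) x

theorem phi_eventuallyEq_bary (hT : T ∈ M.simplices) {x : Rd d} (hx : x ∈ interior (hull T))
    (k : Rd d) : M.phi k =ᶠ[𝓝 x] bary T k := by
  filter_upwards [mem_interior_iff_mem_nhds.1 hx] with y hy
  exact phi_eq_bary hT hy k

theorem hasFDerivAt_phi (hT : T ∈ M.simplices) {x : Rd d} (hx : x ∈ interior (hull T))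
    (k : Rd d) : HasFDerivAt (M.phi k) (baryGrad T k) x :=
  (hasFDerivAt_bary T k x).congr_of_eventuallyEq (phi_eventuallyEq_bary hT hx k)

end NodalBasis

section Decomposition

theorem aedisjoint_hull {T T' : Finset (Rd d)} (hT : T ∈ M.simplices) (hT' : T' ∈ M.simplices)
    (hne : T ≠ T') : AEDisjoint volume (hull T) (hull T') := by
  obtain ⟨k, hk, hk'⟩ : ∃ k ∈ T, k ∉ T' := by
    by_contra! hsub
    exact hne (Finset.eq_of_subset_of_card_le hsub (by rw [hT.2, hT'.2]))
  refine measure_mono_null (fun x hx => ?_)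
    (addHaar_affineMap_eq_zero volume (f := (bary T k : Rd d →ᵃ[ℝ] ℝ)) (p := k)
      (by simp [(isSimplex hT).bary_self hk]))
  exact (bary_eq_bary hT hT' hx.1 hx.2 k).trans (DFunLike.congr_fun (bary_of_notMem hk') x)

theorem setIntegral_biUnion_hull {F : Type*} [NormedAddCommGroup F] [NormedSpace ℝ F]
    {S : Finset (Finset (Rd d))} (hS : S ⊆ M.elements) {f : Rd d → F}
    (hf : IntegrableOn f (⋃ T ∈ S, hull T)) :
    ∫ x in ⋃ T ∈ S, hull T, f x = ∑ T ∈ S, ∫ x in hull T, f x := by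
  have hmem (T : S) : (T : Finset (Rd d)) ∈ M.simplices := mem_elements.1 (hS T.2)
  have hunion : ⋃ T ∈ S, hull T = ⋃ T : S, hull (T : Finset (Rd d)) := biUnion_eq_iUnion _ _
  rw [hunion] at hf ⊢
  rw [integral_iUnion_ae (fun T => (isClosed_hull _).measurableSet.nullMeasurableSet)
    (fun T T' hne => aedisjoint_hull (hmem T) (hmem T') (Subtype.coe_ne_coe.2 hne)) hf,
    tsum_fintype, Finset.sum_coe_sort S fun T => ∫ x in hull T, f x]

theorem exists_mem_interior_hull_ae :
    ∀ᵐ x, x ∈ M.complex.space → ∃ T ∈ M.simplices, x ∈ interior (hull T) := by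
  have hfrontier : ∀ᵐ x, ∀ T ∈ M.elements, x ∉ frontier (hull T) :=
    (ae_ball_iff M.elements.countable_toSet).2 fun T _ =>
      measure_eq_zero_iff_ae_notMem.1 (volume_frontier_hull T)
  filter_upwards [hfrontier] with x hx hxs
  obtain ⟨T, hT, hxT⟩ := exists_mem_hull hxs
  exact ⟨T, hT, not_not.1 fun hn => hx T (mem_elements.2 hT) ⟨subset_closure hxT, hn⟩⟩

theorem domain_ae_eq_space : M.domain =ᵐ[volume] M.complex.space := by
  filter_upwards [exists_mem_interior_hull_ae (M := M)] with x hx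
  refine propext ⟨fun h => domain_subset_space h, fun h => ?_⟩
  obtain ⟨T, hT, hxT⟩ := hx h
  exact interior_hull_subset_domain hT hxT

theorem restrict_domain_eq_restrict_space :
    volume.restrict M.domain = volume.restrict M.complex.space :=
  Measure.restrict_congr_set domain_ae_eq_space

theorem exists_mem_interior_hull_ae_domain :
    ∀ᵐ x ∂volume.restrict M.domain, ∃ T ∈ M.simplices, x ∈ interior (hull T) := by
  rw [restrict_domain_eq_restrict_space, ae_restrict_iff' isCompact_space.measurableSet]
  exact exists_mem_interior_hull_ae

theorem setIntegral_domain_eq_sum {F : Type*} [NormedAddCommGroup F] [NormedSpace ℝ F]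
    {f : Rd d → F} (hf : IntegrableOn f M.domain) :
    ∫ x in M.domain, f x = ∑ T ∈ M.elements, ∫ x in hull T, f x := by
  rw [IntegrableOn, restrict_domain_eq_restrict_space, space_eq_biUnion_hull] at hf
  rw [restrict_domain_eq_restrict_space, space_eq_biUnion_hull,
    setIntegral_biUnion_hull subset_rfl hf]

end Decomposition

section Edges

variable {i j : Rd d}

theorem isEdge_iff : M.IsEdge i j ↔ i ≠ j ∧ ∃ T ∈ M.simplices, i ∈ T ∧ j ∈ T := by
  classical
  refine and_congr_right fun _ => ⟨fun hij => ?_, fun ⟨T, hT, hi, hj⟩ => ?_⟩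
  · obtain ⟨T, hT, hsub, hcard⟩ := M.pure _ hij
    exact ⟨T, ⟨hT, hcard⟩, hsub (by simp), hsub (by simp)⟩
  · refine M.complex.down_closed hT.1 ?_ (by simp)
    exact Finset.insert_subset hi (Finset.singleton_subset_iff.2 hj)

theorem IsEdge.ne (h : M.IsEdge i j) : i ≠ j := h.1

theorem IsEdge.symm (h : M.IsEdge i j) : M.IsEdge j i :=
  ⟨h.1.symm, by simpa only [Finset.pair_comm] using h.2⟩

theorem IsEdge.left_mem (h : M.IsEdge i j) : i ∈ M.nodes := by
  obtain ⟨-, T, hT, hi, -⟩ := isEdge_iff.1 h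
  exact mem_nodes_iff.2 ⟨T, hT, hi⟩

theorem IsEdge.right_mem (h : M.IsEdge i j) : j ∈ M.nodes := h.symm.left_mem

theorem IsBoundaryEdge.symm (h : M.IsBoundaryEdge i j) : M.IsBoundaryEdge j i :=
  ⟨h.1.symm, by rw [segment_symm]; exact h.2⟩

theorem IsInteriorEdge.symm (h : M.IsInteriorEdge i j) : M.IsInteriorEdge j i :=
  ⟨h.1.symm, by rw [segment_symm]; exact h.2⟩

theorem IsBoundaryEdge.left_notMem (h : M.IsBoundaryEdge i j) : i ∉ M.domain := fun hi =>
  disjoint_left.1 disjoint_domain_frontier hi (h.2 (left_mem_segment ℝ i j))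

theorem IsEdge.isInteriorEdge (h : M.IsEdge i j) (hj : j ∈ M.domain) : M.IsInteriorEdge i j :=
  ⟨h, fun hs => disjoint_left.1 disjoint_domain_frontier hj (hs (right_mem_segment ℝ i j))⟩

theorem IsBoundaryEdge.isInteriorEdge_left (h : M.IsBoundaryEdge i j) {T : Finset (Rd d)}
    (hT : T ∈ M.simplices) (hi : i ∈ T) {m : Rd d} (hmT : m ∈ T) (hm : m ∈ M.domain) :
    M.IsInteriorEdge i m :=
  IsEdge.isInteriorEdge
    (isEdge_iff.2 ⟨(ne_of_mem_of_not_mem hm h.left_notMem).symm, T, hT, hi, hmT⟩) hm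

theorem exists_isChoice (hM : M.HasInteriorNodes) : ∃ m, M.IsChoice m := by
  classical
  have hnode (e : Finset (Rd d)) : ∃ m : Rd d, ∀ i j, e = {i, j} → M.IsBoundaryEdge i j →
      m ∈ M.nodes ∧ m ∈ M.domain ∧ M.IsInteriorEdge i m ∧ M.IsInteriorEdge j m := by
    by_cases he : ∃ T ∈ M.simplices, e ⊆ T
    · obtain ⟨T, hT, heT⟩ := he
      obtain ⟨m, hmT, hm⟩ := hM T hT
      refine ⟨m, ?_⟩
      rintro i j rfl hb
      exact ⟨mem_nodes_iff.2 ⟨T, hT, hmT⟩, hm,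
        hb.isInteriorEdge_left hT (heT (by simp)) hmT hm,
        hb.symm.isInteriorEdge_left hT (heT (by simp)) hmT hm⟩
    · refine ⟨0, ?_⟩
      rintro i j rfl hb
      obtain ⟨-, T, hT, hi, hj⟩ := isEdge_iff.1 hb.1
      exact absurd ⟨T, hT, Finset.insert_subset hi (Finset.singleton_subset_iff.2 hj)⟩ he
  choose f hf using hnode
  refine ⟨fun i j => f {i, j}, fun i j hb => ⟨?_, hf _ i j rfl hb⟩⟩
  exact congrArg f (Finset.pair_comm i j)

theorem psi_mem_edgeSpace {m : Rd d → Rd d → Rd d} (hm : M.IsChoice m) (h : M.IsEdge i j) :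
    M.psi m i j ∈ M.edgeSpace := by
  have hb {k l : Rd d} (hkl : M.IsInteriorEdge k l) : M.b k l ∈ M.edgeSpace :=
    Submodule.smul_mem _ _ (Submodule.subset_span ⟨k, l, hkl, rfl⟩)
  rw [psi]
  split_ifs with hbd
  · obtain ⟨-, -, -, him, hjm⟩ := hm i j hbd
    exact Submodule.add_mem _ (hb him) (hb hjm.symm)
  · exact hb ⟨h, fun hs => hbd ⟨h, hs⟩⟩

theorem pi2_mem_edgeSpace {m : Rd d → Rd d → Rd d} (hm : M.IsChoice m) (v : Rd d → Rd d) :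
    M.Pi2 m v ∈ M.edgeSpace := by
  classical
  refine Submodule.sum_mem _ fun i _ => Submodule.neg_mem _ (Submodule.sum_mem _ fun j hj => ?_)
  exact Submodule.smul_mem _ _ (psi_mem_edgeSpace hm (Finset.mem_filter.1 hj).2.symm)

end Edges

end Mesh

section Lipschitz

theorem dist_le_of_lipschitzOnWith_closed_cover {Y ι : Type*} [PseudoMetricSpace Y] [Finite ι]
    {A : ι → Set ℝ} {a b : ℝ} (hab : a ≤ b) (hA : ∀ i, IsClosed (A i))
    (hcover : Icc a b ⊆ ⋃ i, A i) {f : ℝ → Y} {K : ℝ≥0}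
    (hf : ∀ i, LipschitzOnWith K f (Icc a b ∩ A i)) : dist (f a) (f b) ≤ K * (b - a) := by
  have hcont : ContinuousOn f (Icc a b) := by
    rw [← inter_eq_left.2 hcover, inter_iUnion]
    exact (locallyFinite_of_finite _).continuousOn_iUnion (fun i => isClosed_Icc.inter (hA i))
      fun i => (hf i).continuousOn
  have hclosed : IsClosed ({t | dist (f a) (f t) ≤ K * (t - a)} ∩ Icc a b) := by
    rw [inter_comm]
    exact isClosed_Icc.isClosed_le (f := fun t => dist (f a) (f t)) (g := fun t => K * (t - a))
      (by fun_prop) (by fun_prop)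
  refine hclosed.Icc_subset_of_forall_exists_gt (by simp) ?_ (right_mem_Icc.2 hab)
  rintro t ⟨ht, hat, htb⟩ u hu
  obtain ⟨i, hi⟩ : ∃ i, ∃ᶠ z in 𝓝[>] t, z ∈ A i := by
    by_contra! h
    have hIoc : ∀ᶠ z in 𝓝[>] t, z ∈ Ioc t b := Ioc_mem_nhdsGT htb
    obtain ⟨z, hz, hzA⟩ := (hIoc.and (eventually_all.2 h)).exists
    obtain ⟨i, hi⟩ := mem_iUnion.1 (hcover ⟨hat.trans hz.1.le, hz.2⟩)
    exact hzA i hi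
  have htA : t ∈ A i := (hA i).closure_subset
    (mem_closure_iff_frequently.2 (hi.filter_mono nhdsWithin_le_nhds))
  obtain ⟨z, hzA, hzu, hzb⟩ := (hi.and_eventually
    (Filter.Eventually.and (Ioc_mem_nhdsGT hu) (Ioc_mem_nhdsGT htb))).exists
  refine ⟨z, ?_, hzu⟩
  calc dist (f a) (f z) ≤ dist (f a) (f t) + dist (f t) (f z) := dist_triangle _ _ _
    _ ≤ K * (t - a) + K * dist t z := by
        gcongr
        · exact ht
        · exact (hf i).dist_le_mul _ ⟨⟨hat, htb.le⟩, htA⟩ _ ⟨⟨hat.trans hzu.1.le, hzb.2⟩, hzA⟩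
    _ = K * (z - a) := by rw [dist_comm, Real.dist_eq, abs_of_pos (sub_pos.2 hzu.1)]; ring

variable {E : Type*} [NormedAddCommGroup E] [NormedSpace ℝ E]

theorem lipschitzOnWith_of_closed_cover {Y ι : Type*} [PseudoMetricSpace Y] [Finite ι] {C : Set E}
    (hC : Convex ℝ C) {A : ι → Set E} (hA : ∀ i, IsClosed (A i)) (hcover : C ⊆ ⋃ i, A i)
    {f : E → Y} {K : ℝ≥0} (hf : ∀ i, LipschitzOnWith K f (C ∩ A i)) : LipschitzOnWith K f C := by
  refine LipschitzOnWith.of_dist_le_mul fun x hx y hy => ?_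
  let γ : ℝ → E := AffineMap.lineMap x y
  have hγ : LipschitzWith (nndist x y) γ := lipschitzWith_lineMap x y
  have hmem : MapsTo γ (Icc 0 1) C := fun t ht => hC.lineMap_mem hx hy ht
  have hdist := dist_le_of_lipschitzOnWith_closed_cover zero_le_one
    (fun i => (hA i).preimage hγ.continuous)
    (fun t ht => by simpa only [mem_iUnion, mem_preimage] using hcover (hmem ht))
    (fun i => (hf i).comp hγ.lipschitzOnWith fun t ht => ⟨hmem ht.1, ht.2⟩)
  simpa [γ] using hdist

theorem exists_lipschitzWith_of_hasCompactSupport {Y : Type*} [PseudoMetricSpace Y] [Zero Y]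
    [T1Space Y] {f : E → Y} (hf : LocallyLipschitz f) (hcs : HasCompactSupport f) :
    ∃ K, LipschitzWith K f := by
  obtain ⟨K, hK⟩ := hf.locallyLipschitzOn.exists_lipschitzOnWith_of_compact hcs.isCompact
  let A : Bool → Set E := fun i => cond i (tsupport f) (f ⁻¹' {0})
  refine ⟨K, lipschitzOnWith_univ.1 ?_⟩
  refine lipschitzOnWith_of_closed_cover (A := A) convex_univ ?_ ?_ ?_
  · rintro (_ | _)
    exacts [isClosed_singleton.preimage hf.continuous, isClosed_tsupport f]
  · refine fun x _ => mem_iUnion.2 ?_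
    by_cases hx : f x = 0
    exacts [⟨false, hx⟩, ⟨true, subset_tsupport f hx⟩]
  · rintro (_ | _)
    · refine LipschitzOnWith.of_dist_le_mul fun x hx y hy => ?_
      rw [hx.2, hy.2, dist_self]
      positivity
    · exact hK.mono inter_subset_right

theorem lipschitzOnWith_mul_of_bdd {X : Type*} [PseudoMetricSpace X] {s : Set X} {f g : X → ℝ}
    {K L B D : ℝ≥0} (hf : LipschitzOnWith K f s) (hg : LipschitzOnWith L g s)
    (hB : ∀ x ∈ s, |f x| ≤ B) (hD : ∀ x ∈ s, |g x| ≤ D) :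
    LipschitzOnWith (B * L + K * D) (fun x => f x * g x) s := by
  refine LipschitzOnWith.of_dist_le_mul fun x hx y hy => ?_
  calc dist (f x * g x) (f y * g y)
      ≤ dist (f x * g x) (f x * g y) + dist (f x * g y) (f y * g y) := dist_triangle _ _ _
    _ = |f x| * dist (g x) (g y) + dist (f x) (f y) * |g y| := by
        simp only [Real.dist_eq, ← abs_mul, mul_sub, sub_mul]
    _ ≤ B * (L * dist x y) + K * dist x y * D := by
        gcongr
        exacts [hB x hx, hg.dist_le_mul x hx y hy, hf.dist_le_mul x hx y hy, hD y hy]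
    _ = (B * L + K * D : ℝ≥0) * dist x y := by push_cast; ring

theorem integral_fderiv_eq_zero [FiniteDimensional ℝ E] [MeasurableSpace E] [BorelSpace E]
    (μ : Measure E) [μ.IsAddHaarMeasure] {f : E → ℝ} {K : ℝ≥0} (hf : LipschitzWith K f)
    (hcs : HasCompactSupport f) (e : E) : ∫ x, fderiv ℝ f x e ∂μ = 0 := by
  have hparts := (LipschitzWith.const (1 : ℝ)).integral_lineDeriv_mul_eq (μ := μ) hf hcs (-e)
  simp only [lineDeriv, deriv_const, zero_mul, integral_zero, neg_neg, mul_one] at hparts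
  refine Eq.trans (integral_congr_ae ?_) hparts.symm
  filter_upwards [hf.ae_differentiableAt] with x hx
  exact hx.lineDeriv_eq_fderiv.symm

end Lipschitz

section BoundedLipschitz

variable {d : ℕ}

/-- `f` belongs to `W^{1,∞}(Ω)`, in the form used for the nodal basis functions: it is bounded on
`Ω`, and locally Lipschitz there with a uniform constant. By Rademacher's theorem its weak gradient
is `fderiv ℝ f`. -/
structure MemW1Inf (Ω : Set (Rd d)) (f : Rd d → ℝ) : Prop where
  bdd : ∃ B : ℝ≥0, ∀ x ∈ Ω, |f x| ≤ B
  lip : ∃ K : ℝ≥0, ∀ x ∈ Ω, ∃ U ∈ 𝓝 x, LipschitzOnWith K f U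

namespace MemW1Inf

variable {Ω : Set (Rd d)} {f g : Rd d → ℝ}

theorem mul (hf : MemW1Inf Ω f) (hg : MemW1Inf Ω g) (hΩ : IsOpen Ω) :
    MemW1Inf Ω fun x => f x * g x := by
  obtain ⟨B, hB⟩ := hf.bdd
  obtain ⟨D, hD⟩ := hg.bdd
  obtain ⟨K, hK⟩ := hf.lip
  obtain ⟨L, hL⟩ := hg.lip
  refine ⟨⟨B * D, fun x hx => ?_⟩, B * L + K * D, fun x hx => ?_⟩
  · rw [abs_mul, NNReal.coe_mul]
    gcongr
    exacts [hB x hx, hD x hx]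
  · obtain ⟨U, hU, hfU⟩ := hK x hx
    obtain ⟨V, hV, hgV⟩ := hL x hx
    refine ⟨U ∩ V ∩ Ω, inter_mem (inter_mem hU hV) (hΩ.mem_nhds hx), ?_⟩
    exact lipschitzOnWith_mul_of_bdd (hfU.mono fun y hy => hy.1.1) (hgV.mono fun y hy => hy.1.2)
      (fun y hy => hB y hy.2) fun y hy => hD y hy.2

theorem exists_lipschitzWith (hf : MemW1Inf Ω f) (hcs : HasCompactSupport f)
    (hsub : tsupport f ⊆ Ω) : ∃ K, LipschitzWith K f := by
  refine exists_lipschitzWith_of_hasCompactSupport (fun x => ?_) hcs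
  by_cases hx : x ∈ Ω
  · obtain ⟨K, hK⟩ := hf.lip
    exact ⟨K, hK x hx⟩
  · have hzero : f =ᶠ[𝓝 x] 0 := notMem_tsupport_iff_eventuallyEq.1 fun h => hx (hsub h)
    exact ⟨0, _, hzero, fun y hy z hz => by rw [hy, hz]; simp⟩

theorem continuousOn (hf : MemW1Inf Ω f) : ContinuousOn f Ω := fun x hx => by
  obtain ⟨K, hK⟩ := hf.lip
  obtain ⟨U, hU, hfU⟩ := hK x hx
  exact (hfU.continuousOn.continuousAt hU).continuousWithinAt

theorem ae_differentiableAt (hf : MemW1Inf Ω f) (hΩ : IsOpen Ω) :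
    ∀ᵐ x ∂volume.restrict Ω, DifferentiableAt ℝ f x := by
  rw [ae_restrict_iff' hΩ.measurableSet]
  refine measure_null_of_locally_null _ fun x hx => ?_
  obtain ⟨K, hK⟩ := hf.lip
  obtain ⟨U, hU, hfU⟩ := hK x (Classical.not_imp.1 hx).1
  have hdiff := (hfU.mono interior_subset).ae_differentiableWithinAt_of_mem (μ := volume)
  refine ⟨_, inter_mem_nhdsWithin _ (interior_mem_nhds.2 hU), ?_⟩
  refine measure_mono_null (fun y hy => ?_) hdiff
  exact fun h => hy.1 fun _ => (h hy.2).differentiableAt (isOpen_interior.mem_nhds hy.2)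

theorem exists_norm_fderiv_le (hf : MemW1Inf Ω f) :
    ∃ K : ℝ≥0, ∀ x ∈ Ω, ‖fderiv ℝ f x‖ ≤ K := by
  obtain ⟨K, hK⟩ := hf.lip
  refine ⟨K, fun x hx => ?_⟩
  obtain ⟨U, hU, hfU⟩ := hK x hx
  exact norm_fderiv_le_of_lipschitzOn ℝ hU hfU

theorem aestronglyMeasurable (hf : MemW1Inf Ω f) (hΩ : IsOpen Ω) :
    AEStronglyMeasurable f (volume.restrict Ω) :=
  hf.continuousOn.aestronglyMeasurable hΩ.measurableSet

theorem integrable_mul (hf : MemW1Inf Ω f) (hΩ : IsOpen Ω) {u : Rd d → ℝ}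
    (hu : IntegrableOn u Ω) : IntegrableOn (fun x => f x * u x) Ω := by
  obtain ⟨B, hB⟩ := hf.bdd
  exact Integrable.bdd_mul hu (hf.aestronglyMeasurable hΩ)
    (ae_restrict_of_forall_mem hΩ.measurableSet hB)

theorem integrable_fderiv_apply (hf : MemW1Inf Ω f) (hΩ : IsOpen Ω) {v : Rd d → Rd d}
    (hv : IntegrableOn v Ω) : IntegrableOn (fun x => fderiv ℝ f x (v x)) Ω := by
  obtain ⟨K, hK⟩ := hf.exists_norm_fderiv_le
  exact (ContinuousLinearMap.id ℝ (Rd d →L[ℝ] ℝ)).integrable_of_bilin_of_bdd_left K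
    (measurable_fderiv ℝ f).aestronglyMeasurable
    (ae_restrict_of_forall_mem hΩ.measurableSet hK) hv

theorem setIntegral_fderiv_eq_zero (hf : MemW1Inf Ω f) (hcs : HasCompactSupport f)
    (hsub : tsupport f ⊆ Ω) (e : Rd d) : ∫ x in Ω, fderiv ℝ f x e = 0 := by
  obtain ⟨K, hK⟩ := hf.exists_lipschitzWith hcs hsub
  rw [setIntegral_eq_integral_of_forall_compl_eq_zero, integral_fderiv_eq_zero volume hK hcs]
  intro x hx
  rw [fderiv_of_notMem_tsupport ℝ fun h => hx (hsub h)]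
  rfl

end MemW1Inf

theorem IsTestFunction.memW1Inf {Ω : Set (Rd d)} {η : Rd d → ℝ} (hη : IsTestFunction Ω η) :
    MemW1Inf Ω η := by
  obtain ⟨hsmooth, hcs, -⟩ := hη
  obtain ⟨B, hB⟩ := hcs.exists_bound_of_continuous hsmooth.continuous
  obtain ⟨K, hK⟩ := hsmooth.lipschitzWith_of_hasCompactSupport hcs (by simp)
  exact ⟨⟨B.toNNReal, fun x _ => (hB x).trans (Real.le_coe_toNNReal B)⟩,
    K, fun x _ => ⟨univ, univ_mem, hK.lipschitzOnWith⟩⟩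

theorem MemW1Inf.integral_fderiv_mul {Ω : Set (Rd d)} (hΩ : IsOpen Ω)
    [IsFiniteMeasure (volume.restrict Ω)] {f η : Rd d → ℝ} (hf : MemW1Inf Ω f)
    (hη : IsTestFunction Ω η) (e : Rd d) :
    ∫ x in Ω, fderiv ℝ η x e * f x = -∫ x in Ω, η x * fderiv ℝ f x e := by
  have hηf := hη.memW1Inf.mul hf hΩ
  have hzero := hηf.setIntegral_fderiv_eq_zero hη.2.1.mul_right
    ((closure_mono (Function.support_mul_subset_left η f)).trans hη.2.2) e
  have hprod : (fun x => fderiv ℝ (fun y => η y * f y) x e) =ᵐ[volume.restrict Ω]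
      fun x => fderiv ℝ η x e * f x + η x * fderiv ℝ f x e := by
    filter_upwards [hf.ae_differentiableAt hΩ] with x hx
    rw [fderiv_fun_mul (hη.1.differentiable (by simp) x) hx]
    simp [mul_comm, add_comm]
  have hint₁ : IntegrableOn (fun x => fderiv ℝ η x e * f x) Ω := by
    simpa only [mul_comm] using
      hf.integrable_mul hΩ (hη.memW1Inf.integrable_fderiv_apply hΩ (integrable_const e))
  have hint₂ : IntegrableOn (fun x => η x * fderiv ℝ f x e) Ω :=
    hη.memW1Inf.integrable_mul hΩ (hf.integrable_fderiv_apply hΩ (integrable_const e))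
  rw [integral_congr_ae hprod, integral_add hint₁ hint₂] at hzero
  exact eq_neg_of_add_eq_zero_left hzero

theorem Mesh.memW1Inf_phi (M : Mesh d) (k : Rd d) : MemW1Inf M.domain (M.phi k) := by
  let K : ℝ≥0 := ∑ T ∈ M.elements, ‖baryGrad T k‖₊
  have hK (T : M.elements) {A : Set (Rd d)} : LipschitzOnWith K (M.phi k) (A ∩ hull T.1) := by
    have hle : ‖baryGrad T.1 k‖₊ ≤ K :=
      Finset.single_le_sum (f := fun T => ‖baryGrad T k‖₊) (fun _ _ => zero_le) T.2
    refine (LipschitzOnWith.of_dist_le_mul fun x hx y hy => ?_).weaken hle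
    rw [phi_eq_bary (mem_elements.1 T.2) hx.2, phi_eq_bary (mem_elements.1 T.2) hy.2,
      Real.dist_eq, bary_sub_bary, dist_eq_norm]
    exact (baryGrad T.1 k).le_opNorm _
  refine ⟨⟨1, fun x hx => abs_phi_le_one (domain_subset_space hx) k⟩, K, fun x hx => ?_⟩
  obtain ⟨ε, hε, hball⟩ := Metric.isOpen_iff.1 isOpen_domain x hx
  refine ⟨Metric.ball x ε, Metric.ball_mem_nhds x hε, ?_⟩
  refine lipschitzOnWith_of_closed_cover (convex_ball x ε) (A := fun T : M.elements => hull T.1)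
    (fun T => isClosed_hull _) ?_ fun T => hK T
  intro y hy
  obtain ⟨T, hT, hyT⟩ := exists_mem_hull (domain_subset_space (hball hy))
  exact mem_iUnion.2 ⟨⟨T, mem_elements.2 hT⟩, hyT⟩

end BoundedLipschitz

section WeakDivergence

variable {d : ℕ} {Ω : Set (Rd d)}

namespace IsTestFunction

variable {F F' : Type*} [NormedAddCommGroup F] [NormedSpace ℝ F] [NormedAddCommGroup F']
  [NormedSpace ℝ F'] {u : Rd d → F}

theorem clm_apply (hu : IsTestFunction Ω u) (L : F →L[ℝ] F') :
    IsTestFunction Ω fun x => L (u x) :=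
  ⟨L.contDiff.comp hu.1, hu.2.1.comp_left (map_zero L),
    (tsupport_comp_subset (map_zero L) u).trans hu.2.2⟩

theorem fderiv_right (hu : IsTestFunction Ω u) : IsTestFunction Ω (fderiv ℝ u) :=
  ⟨hu.1.fderiv_right (by simp), hu.2.1.fderiv ℝ, (tsupport_fderiv_subset ℝ).trans hu.2.2⟩

theorem integrable (hu : IsTestFunction Ω u) : Integrable u :=
  hu.1.continuous.integrable_of_hasCompactSupport hu.2.1

theorem integrable_smul {η : Rd d → ℝ} (hη : IsTestFunction Ω η) {w : Rd d → F}
    (hw : IntegrableOn w Ω) : IntegrableOn (fun x => η x • w x) Ω := by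
  obtain ⟨C, hC⟩ := hη.2.1.exists_bound_of_continuous hη.1.continuous
  exact Integrable.bdd_smul hw C hη.1.continuous.aestronglyMeasurable (ae_of_all _ hC)

theorem integrable_fderiv_smul {η : Rd d → ℝ} (hη : IsTestFunction Ω η) (e : Rd d)
    {w : Rd d → F} (hw : IntegrableOn w Ω) : IntegrableOn (fun x => fderiv ℝ η x e • w x) Ω :=
  (hη.fderiv_right.clm_apply (ContinuousLinearMap.apply ℝ ℝ e)).integrable_smul hw

theorem fderiv_component {u : Rd d → Rd d} (hu : IsTestFunction Ω u) (a : Fin d) (x e : Rd d) :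
    fderiv ℝ (fun y => u y a) x e = fderiv ℝ u x e a := by
  have hdiff : HasFDerivAt u (fderiv ℝ u x) x :=
    (hu.1.differentiable (by simp) x).hasFDerivAt
  have hcomp := (EuclideanSpace.proj (𝕜 := ℝ) a).hasFDerivAt.comp x hdiff
  exact DFunLike.congr_fun hcomp.fderiv e

end IsTestFunction

/-- The trace as a continuous linear functional on the endomorphisms of `ℝᵈ`. -/
def traceCLM (d : ℕ) : (Rd d →L[ℝ] Rd d) →L[ℝ] ℝ :=
  (LinearMap.trace ℝ (Rd d) ∘ₗ ContinuousLinearMap.coeLM ℝ).toContinuousLinearMap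

theorem divOf_eq_traceCLM (G : Rd d → Rd d →L[ℝ] Rd d) (x : Rd d) :
    divOf G x = traceCLM d (G x) := by
  simp [divOf, traceCLM, LinearMap.trace_eq_sum_inner _ (EuclideanSpace.basisFun (Fin d) ℝ),
    EuclideanSpace.inner_single_left]

theorem traceCLM_smulRight (L : Rd d →L[ℝ] ℝ) (w : Rd d) : traceCLM d (L.smulRight w) = L w :=
  LinearMap.trace_smulRight (L : Rd d →ₗ[ℝ] ℝ) w

theorem MemW1Inf.integrable_mul_divOf {f : Rd d → ℝ} (hf : MemW1Inf Ω f) (hΩ : IsOpen Ω)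
    {G : Rd d → Rd d →L[ℝ] Rd d} (hG : IntegrableOn G Ω) :
    IntegrableOn (fun x => divOf G x * f x) Ω := by
  simp only [divOf_eq_traceCLM, mul_comm _ (f _)]
  exact hf.integrable_mul hΩ ((traceCLM d).integrable_comp hG)

theorem tendsto_integral_clm_apply {X ι E F : Type*} [MeasurableSpace X] {μ : Measure X}
    [NormedAddCommGroup E] [NormedSpace ℝ E] [NormedAddCommGroup F] [NormedSpace ℝ F]
    {L : X → E →L[ℝ] F} (hL : AEStronglyMeasurable L μ) {C : ℝ} (hC : ∀ᵐ x ∂μ, ‖L x‖ ≤ C)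
    {l : Filter ι} {u : ι → X → E} {v : X → E} (hu : ∀ n, Integrable (u n) μ)
    (hv : Integrable v μ) (hlim : Tendsto (fun n => ∫ x, ‖u n x - v x‖ ∂μ) l (𝓝 0)) :
    Tendsto (fun n => ∫ x, L x (u n x) ∂μ) l (𝓝 (∫ x, L x (v x) ∂μ)) := by
  have hint {w : X → E} (hw : Integrable w μ) : Integrable (fun x => L x (w x)) μ :=
    (ContinuousLinearMap.id ℝ (E →L[ℝ] F)).integrable_of_bilin_of_bdd_left C hL hC hw
  rw [tendsto_iff_norm_sub_tendsto_zero]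
  refine squeeze_zero (fun _ => norm_nonneg _) (fun n => ?_) (by simpa using hlim.const_mul C)
  rw [← integral_sub (hint (hu n)) (hint hv), ← integral_const_mul]
  refine norm_integral_le_of_norm_le (((hu n).sub hv).norm.const_mul C) ?_
  filter_upwards [hC] with x hx
  rw [← map_sub]
  exact (L x).le_of_opNorm_le hx _

theorem MemW1Inf.integral_divOf_mul_of_isTestFunction (hΩ : IsOpen Ω)
    [IsFiniteMeasure (volume.restrict Ω)] {f : Rd d → ℝ} (hf : MemW1Inf Ω f) {u : Rd d → Rd d}
    (hu : IsTestFunction Ω u) :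
    ∫ x in Ω, divOf (fderiv ℝ u) x * f x = -∫ x in Ω, fderiv ℝ f x (u x) := by
  have hcomp (a : Fin d) : IsTestFunction Ω fun x => u x a :=
    hu.clm_apply (EuclideanSpace.proj (𝕜 := ℝ) a)
  have hdiv (x : Rd d) : divOf (fderiv ℝ u) x * f x =
      ∑ a, fderiv ℝ (fun y => u y a) x (EuclideanSpace.single a 1) * f x := by
    simp only [divOf, Finset.sum_mul, hu.fderiv_component]
  have hgrad (x : Rd d) : fderiv ℝ f x (u x) =
      ∑ a, u x a * fderiv ℝ f x (EuclideanSpace.single a 1) := by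
    conv_lhs => rw [← (EuclideanSpace.basisFun (Fin d) ℝ).sum_repr (u x)]
    simp
  simp only [hdiv, hgrad]
  rw [integral_finsetSum, integral_finsetSum, ← Finset.sum_neg_distrib]
  · exact Finset.sum_congr rfl fun a _ => hf.integral_fderiv_mul hΩ (hcomp a) _
  · exact fun a _ => (hcomp a).integrable_smul
      (hf.integrable_fderiv_apply hΩ (integrable_const (EuclideanSpace.single a 1)))
  · intro a _
    simp only [mul_comm _ (f _)]
    exact hf.integrable_mul hΩ ((hcomp a).fderiv_right.clm_apply
      (ContinuousLinearMap.apply ℝ ℝ (EuclideanSpace.single a 1))).integrable.integrableOn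

theorem MemW1Inf.integral_divOf_mul (hΩ : IsOpen Ω) [IsFiniteMeasure (volume.restrict Ω)]
    {f : Rd d → ℝ} (hf : MemW1Inf Ω f) {v : Rd d → Rd d} {G : Rd d → Rd d →L[ℝ] Rd d}
    (hv : MemW110 Ω v G) :
    ∫ x in Ω, divOf G x * f x = -∫ x in Ω, fderiv ℝ f x (v x) := by
  obtain ⟨u, hu, hlim, hlim'⟩ := hv.approx
  obtain ⟨K, hK⟩ := hf.exists_norm_fderiv_le
  obtain ⟨B, hB⟩ := hf.bdd
  have hrhs := tendsto_integral_clm_apply (measurable_fderiv ℝ f).aestronglyMeasurable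
    (ae_restrict_of_forall_mem hΩ.measurableSet hK)
    (fun n => (hu n).integrable.integrableOn) hv.integrable hlim
  have hlhs : Tendsto (fun n => ∫ x in Ω, divOf (fderiv ℝ (u n)) x * f x) atTop
      (𝓝 (∫ x in Ω, divOf G x * f x)) := by
    simp only [divOf_eq_traceCLM, mul_comm _ (f _)]
    refine tendsto_integral_clm_apply (L := fun x => f x • traceCLM d)
      (C := B * ‖traceCLM d‖) ((hf.aestronglyMeasurable hΩ).smul_const _)
      (ae_restrict_of_forall_mem hΩ.measurableSet fun x hx => ?_)
      (fun n => (hu n).fderiv_right.integrable.integrableOn) hv.integrable_grad hlim'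
    rw [norm_smul]
    gcongr
    exact hB x hx
  refine tendsto_nhds_unique hlhs ?_
  simp only [fun n => hf.integral_divOf_mul_of_isTestFunction hΩ (hu n)]
  exact hrhs.neg

theorem MemW1Inf.memW11_smul_const (hΩ : IsOpen Ω) [IsFiniteMeasure (volume.restrict Ω)]
    {f : Rd d → ℝ} (hf : MemW1Inf Ω f) (w : Rd d) :
    MemW11 Ω (fun x => f x • w) fun x => (fderiv ℝ f x).smulRight w where
  integrable := by
    simpa [IntegrableOn] using (hf.integrable_mul hΩ (integrable_const (1 : ℝ))).smul_const w
  integrable_grad := by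
    obtain ⟨K, hK⟩ := hf.exists_norm_fderiv_le
    have hint : IntegrableOn (fderiv ℝ f) Ω :=
      Integrable.of_bound (measurable_fderiv ℝ f).aestronglyMeasurable K
        (ae_restrict_of_forall_mem hΩ.measurableSet hK)
    exact ((ContinuousLinearMap.smulRightL ℝ (Rd d) (Rd d)).flip w).integrable_comp hint
  weak η hη e := by
    simp only [ContinuousLinearMap.smulRight_apply, smul_smul]
    rw [integral_smul_const, integral_smul_const, hf.integral_fderiv_mul hΩ hη e, neg_smul]

namespace MemW11

variable {u u' : Rd d → Rd d} {H H' : Rd d → Rd d →L[ℝ] Rd d}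

theorem integrable_smul_grad_apply (hu : MemW11 Ω u H) {η : Rd d → ℝ} (hη : IsTestFunction Ω η)
    (e : Rd d) : IntegrableOn (fun x => η x • H x e) Ω :=
  hη.integrable_smul
    ((ContinuousLinearMap.apply ℝ (Rd d) e).integrable_comp hu.integrable_grad)

theorem zero : MemW11 Ω (0 : Rd d → Rd d) 0 where
  integrable := integrable_zero _ _ _
  integrable_grad := integrable_zero (Rd d) (Rd d →L[ℝ] Rd d) _
  weak := by simp

theorem add (hu : MemW11 Ω u H) (hu' : MemW11 Ω u' H') : MemW11 Ω (u + u') (H + H') where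
  integrable := hu.integrable.add hu'.integrable
  -- `Integrable.add` fails to unify the two additions on `Rd d →L[ℝ] Rd d`.
  integrable_grad := by simpa using hu.integrable_grad.sub hu'.integrable_grad.neg
  weak η hη e := by
    simp only [Pi.add_apply, smul_add, add_apply]
    rw [integral_add (hη.integrable_fderiv_smul e hu.integrable)
        (hη.integrable_fderiv_smul e hu'.integrable),
      integral_add (hu.integrable_smul_grad_apply hη e) (hu'.integrable_smul_grad_apply hη e),
      hu.weak η hη e, hu'.weak η hη e, neg_add]

theorem const_smul (hu : MemW11 Ω u H) (c : ℝ) : MemW11 Ω (c • u) (c • H) where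
  integrable := hu.integrable.smul c
  integrable_grad := hu.integrable_grad.smul c
  weak η hη e := by
    simp only [Pi.smul_apply, smul_apply, smul_comm _ c]
    rw [integral_smul, integral_smul, hu.weak η hη e, smul_neg]

end MemW11

end WeakDivergence

namespace Mesh

variable {d : ℕ} {M : Mesh d}

section DivMoments

/-- `u` belongs to `W^{1,1}`, and `l k` is the moment of its divergence against the nodal basis
function of `k`. -/
def HasDivMoments (M : Mesh d) (u : Rd d → Rd d) (l : Rd d → ℝ) : Prop :=
  ∃ H, MemW11 M.domain u H ∧ ∀ k, ∫ x in M.domain, divOf H x * M.phi k x = l k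

namespace HasDivMoments

variable {u u' : Rd d → Rd d} {l l' : Rd d → ℝ}

theorem zero : M.HasDivMoments 0 0 :=
  ⟨0, MemW11.zero, fun k => by simp [divOf]⟩

theorem add (h : M.HasDivMoments u l) (h' : M.HasDivMoments u' l') :
    M.HasDivMoments (u + u') (l + l') := by
  obtain ⟨H, hH, hl⟩ := h
  obtain ⟨H', hH', hl'⟩ := h'
  refine ⟨H + H', hH.add hH', fun k => ?_⟩
  have hk := M.memW1Inf_phi k
  rw [Pi.add_apply, ← hl, ← hl',
    ← integral_add (hk.integrable_mul_divOf isOpen_domain hH.integrable_grad)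
      (hk.integrable_mul_divOf isOpen_domain hH'.integrable_grad)]
  simp only [divOf_eq_traceCLM, Pi.add_apply, map_add, add_mul]

theorem const_smul (h : M.HasDivMoments u l) (c : ℝ) : M.HasDivMoments (c • u) (c • l) := by
  obtain ⟨H, hH, hl⟩ := h
  refine ⟨c • H, hH.const_smul c, fun k => ?_⟩
  simp only [Pi.smul_apply, ← hl, divOf_eq_traceCLM, map_smul, smul_eq_mul, mul_assoc]
  rw [integral_const_mul]

theorem sum {ι : Type*} {s : Finset ι} {u : ι → Rd d → Rd d} {l : ι → Rd d → ℝ}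
    (h : ∀ a ∈ s, M.HasDivMoments (u a) (l a)) :
    M.HasDivMoments (∑ a ∈ s, u a) (∑ a ∈ s, l a) := by
  classical
  induction s using Finset.induction_on with
  | empty => exact zero
  | insert a s ha ih =>
    rw [Finset.sum_insert ha, Finset.sum_insert ha]
    exact (h a (Finset.mem_insert_self a s)).add
      (ih fun b hb => h b (Finset.mem_insert_of_mem hb))

end HasDivMoments

end DivMoments

section EdgePatch

variable {i j : Rd d} {T : Finset (Rd d)}

open Classical in
/-- The simplices with the edge `[i, j]`, i.e. those that make up the patch `ω_{i,j}`. -/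
def edgeStar (M : Mesh d) (i j : Rd d) : Finset (Finset (Rd d)) :=
  {T ∈ M.elements | i ∈ T ∧ j ∈ T}

theorem mem_edgeStar : T ∈ M.edgeStar i j ↔ T ∈ M.simplices ∧ i ∈ T ∧ j ∈ T := by
  simp [edgeStar, mem_elements]

theorem edgePatch_eq_biUnion (M : Mesh d) (i j : Rd d) :
    M.edgePatch i j = ⋃ T ∈ M.edgeStar i j, hull T := by
  simp only [edgePatch, mem_edgeStar, mem_ofPred_eq]

theorem edgePatch_subset_space (M : Mesh d) (i j : Rd d) :
    M.edgePatch i j ⊆ M.complex.space :=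
  iUnion₂_subset fun _ hT => hull_subset_space hT.1

theorem volume_edgePatch (M : Mesh d) (i j : Rd d) :
    volume.real (M.edgePatch i j) = ∑ T ∈ M.edgeStar i j, volume.real (hull T) := by
  have hcompact : IsCompact (⋃ T ∈ M.edgeStar i j, hull T) :=
    Finset.isCompact_biUnion _ fun T _ => isCompact_hull T
  have hint : IntegrableOn (fun _ => (1 : ℝ)) (⋃ T ∈ M.edgeStar i j, hull T) :=
    continuousOn_const.integrableOn_compact hcompact
  simpa only [edgePatch_eq_biUnion, setIntegral_one_eq_measureReal] using
    setIntegral_biUnion_hull (S := M.edgeStar i j) (Finset.filter_subset _ _) hint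

theorem volume_hull_le_edgePatch (hT : T ∈ M.simplices) (hi : i ∈ T) (hj : j ∈ T) :
    volume.real (hull T) ≤ volume.real (M.edgePatch i j) := by
  rw [volume_edgePatch]
  exact Finset.single_le_sum (f := fun T => volume.real (hull T)) (fun _ _ => measureReal_nonneg)
    (mem_edgeStar.2 ⟨hT, hi, hj⟩)

theorem IsEdge.volume_edgePatch_pos (h : M.IsEdge i j) : 0 < volume.real (M.edgePatch i j) := by
  obtain ⟨-, T, hT, hi, hj⟩ := isEdge_iff.1 h
  exact (isSimplex hT).volume_hull_pos.trans_le (volume_hull_le_edgePatch hT hi hj)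

end EdgePatch

section EdgeBubbles

variable {i j : Rd d} {T : Finset (Rd d)}

theorem setIntegral_hull_fderiv_bubble [DecidableEq (Rd d)] (hij : i ≠ j)
    (hT : T ∈ M.simplices) (k : Rd d) :
    ∫ x in hull T, fderiv ℝ (fun y => M.phi i y * M.phi j y) x (j - i) * M.phi k x =
      if i ∈ T ∧ j ∈ T then volume.real (hull T) / ((d + 1) * (d + 2)) *
        (Pi.single i (1 : ℝ) - Pi.single j (1 : ℝ) : Rd d → ℝ) k else 0 := by
  have hS := isSimplex hT
  have hinterior : ∀ᵐ x ∂volume.restrict (hull T), x ∈ interior (hull T) := by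
    rw [ae_restrict_iff' (isClosed_hull T).measurableSet]
    filter_upwards [measure_eq_zero_iff_ae_notMem.1 (volume_frontier_hull T)] with x hx hxT
    exact not_not.1 fun hn => hx ⟨subset_closure hxT, hn⟩
  have hbary : ∀ᵐ x ∂volume.restrict (hull T),
      fderiv ℝ (fun y => M.phi i y * M.phi j y) x (j - i) * M.phi k x =
        (bary T i x * baryGrad T j (j - i) + bary T j x * baryGrad T i (j - i)) *
          bary T k x := by
    filter_upwards [hinterior] with x hx
    rw [((hasFDerivAt_phi hT hx i).fun_mul (hasFDerivAt_phi hT hx j)).fderiv]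
    simp [phi_eq_bary hT (interior_subset hx)]
  rw [integral_congr_ae hbary]
  split_ifs with hmem
  · rw [← hS.integral_bary_sub_bary_mul hmem.1 hmem.2, hS.baryGrad_sub hmem.1 hmem.2,
      hS.baryGrad_sub hmem.1 hmem.2]
    simp [hij, hij.symm, sub_eq_add_neg]
  · rcases not_and_or.1 hmem with hi | hj
    · simp [baryGrad, bary_of_notMem hi]
    · simp [baryGrad, bary_of_notMem hj]

theorem hasDivMoments_bubble [DecidableEq (Rd d)] (hij : i ≠ j) :
    M.HasDivMoments (M.bubble i j)
      ((volume.real (M.edgePatch i j) / ((d + 1) * (d + 2))) •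
        (Pi.single i (1 : ℝ) - Pi.single j (1 : ℝ))) := by
  have hphi := (M.memW1Inf_phi i).mul (M.memW1Inf_phi j) isOpen_domain
  have hbubble := hphi.memW11_smul_const isOpen_domain (j - i)
  refine ⟨_, hbubble, fun k => ?_⟩
  rw [setIntegral_domain_eq_sum
    ((M.memW1Inf_phi k).integrable_mul_divOf isOpen_domain hbubble.integrable_grad)]
  simp only [divOf_eq_traceCLM, traceCLM_smulRight]
  rw [Finset.sum_congr rfl fun T hT => setIntegral_hull_fderiv_bubble hij (mem_elements.1 hT) k,
    ← Finset.sum_filter, Pi.smul_apply, smul_eq_mul, volume_edgePatch, Finset.sum_div,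
    Finset.sum_mul]
  simp only [edgeStar]
  congr!

theorem b_eq_smul_bubble (M : Mesh d) (i j : Rd d) :
    M.b i j = ((d + 1) * (d + 2) / volume.real (M.edgePatch i j)) • M.bubble i j := by
  have hfactorial : ((2 + d)! : ℝ) = (d + 1) * (d + 2) * d ! := by
    rw [add_comm 2 d, Nat.factorial_succ, Nat.factorial_succ]
    push_cast
    ring
  rw [b, hfactorial, mul_comm (d ! : ℝ), mul_div_mul_right _ _ (by positivity)]

theorem IsEdge.hasDivMoments_b [DecidableEq (Rd d)] (h : M.IsEdge i j) :
    M.HasDivMoments (M.b i j) (Pi.single i (1 : ℝ) - Pi.single j (1 : ℝ)) := by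
  have hvol := h.volume_edgePatch_pos.ne'
  have hnormalized : (d + 1) * (d + 2) / volume.real (M.edgePatch i j) *
      (volume.real (M.edgePatch i j) / ((d + 1) * (d + 2))) = 1 := by
    field_simp
  simpa only [b_eq_smul_bubble, smul_smul, hnormalized, one_smul] using
    (hasDivMoments_bubble (M := M) h.ne).const_smul
      ((d + 1) * (d + 2) / volume.real (M.edgePatch i j))

theorem IsEdge.hasDivMoments_psi [DecidableEq (Rd d)] (h : M.IsEdge i j) {m : Rd d → Rd d → Rd d}
    (hm : M.IsChoice m) :
    M.HasDivMoments (M.psi m i j) (Pi.single i (1 : ℝ) - Pi.single j (1 : ℝ)) := by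
  rw [psi]
  split_ifs with hbd
  · obtain ⟨-, -, -, him, hjm⟩ := hm i j hbd
    simpa only [sub_add_sub_cancel] using him.1.hasDivMoments_b.add hjm.symm.1.hasDivMoments_b
  · exact h.hasDivMoments_b

end EdgeBubbles

section Coefficients

variable {i j : Rd d} {v w : Rd d → Rd d}

/-- The coefficient `⟨φ_i v, ∇φ_j⟩` of `ψ_{j,i}` in `-Π₂ v`. -/
def coef (M : Mesh d) (v : Rd d → Rd d) (i j : Rd d) : ℝ :=
  ∫ x in M.domain, inner ℝ (M.phi i x • v x) (gradient (M.phi j) x)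

open Classical in
theorem pi2_eq_sum (M : Mesh d) (m : Rd d → Rd d → Rd d) (v : Rd d → Rd d) :
    M.Pi2 m v = ∑ i ∈ M.nodes, ∑ j ∈ M.nodes with M.IsEdge i j,
      (-M.coef v i j) • M.psi m j i := by
  simp only [Pi2, Pi2Node, ← Finset.sum_neg_distrib, ← neg_smul, coef]

theorem coef_eq_integral (M : Mesh d) (v : Rd d → Rd d) (i j : Rd d) :
    M.coef v i j = ∫ x in M.domain, M.phi i x * fderiv ℝ (M.phi j) x (v x) := by
  simp [coef]

theorem integrable_phi_mul_fderiv_phi (hv : IntegrableOn v M.domain) (i j : Rd d) :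
    IntegrableOn (fun x => M.phi i x * fderiv ℝ (M.phi j) x (v x)) M.domain :=
  (M.memW1Inf_phi i).integrable_mul isOpen_domain
    ((M.memW1Inf_phi j).integrable_fderiv_apply isOpen_domain hv)

theorem coef_add (hv : IntegrableOn v M.domain) (hw : IntegrableOn w M.domain) (i j : Rd d) :
    M.coef (v + w) i j = M.coef v i j + M.coef w i j := by
  simp only [coef_eq_integral, Pi.add_apply, map_add, mul_add]
  exact integral_add (integrable_phi_mul_fderiv_phi hv i j)
    (integrable_phi_mul_fderiv_phi hw i j)

theorem coef_smul (c : ℝ) (v : Rd d → Rd d) (i j : Rd d) :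
    M.coef (c • v) i j = c * M.coef v i j := by
  simp only [coef_eq_integral, Pi.smul_apply, map_smul, smul_eq_mul, mul_left_comm _ c]
  rw [integral_const_mul]

theorem coef_congr_ae (h : v =ᵐ[volume.restrict M.domain] w) (i j : Rd d) :
    M.coef v i j = M.coef w i j := by
  refine integral_congr_ae ?_
  filter_upwards [h] with x hx
  rw [hx]

theorem pi2_add (m : Rd d → Rd d → Rd d) (hv : IntegrableOn v M.domain)
    (hw : IntegrableOn w M.domain) : M.Pi2 m (v + w) = M.Pi2 m v + M.Pi2 m w := by
  classical
  simp only [pi2_eq_sum, coef_add hv hw, neg_add, add_smul, Finset.sum_add_distrib]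

theorem pi2_smul (m : Rd d → Rd d → Rd d) (c : ℝ) (v : Rd d → Rd d) :
    M.Pi2 m (c • v) = c • M.Pi2 m v := by
  classical
  simp only [pi2_eq_sum, coef_smul, ← mul_neg, mul_smul, Finset.smul_sum]

theorem pi2_congr_ae (m : Rd d → Rd d → Rd d) (h : v =ᵐ[volume.restrict M.domain] w) :
    M.Pi2 m v = M.Pi2 m w := by
  classical
  simp only [pi2_eq_sum, coef_congr_ae h]

theorem phi_mul_fderiv_phi_eq_zero {T : Finset (Rd d)} (hT : T ∈ M.simplices) {x : Rd d}
    (hx : x ∈ interior (hull T)) (h : ¬(i ∈ T ∧ j ∈ T)) (w : Rd d) :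
    M.phi i x * fderiv ℝ (M.phi j) x w = 0 := by
  rw [phi_eq_bary hT (interior_subset hx), (hasFDerivAt_phi hT hx j).fderiv]
  rcases not_and_or.1 h with hi | hj
  · simp [bary_of_notMem hi]
  · simp [baryGrad, bary_of_notMem hj]

theorem coef_eq_setIntegral_edgePatch (M : Mesh d) (v : Rd d → Rd d) (i j : Rd d) :
    M.coef v i j = ∫ x in M.edgePatch i j, M.phi i x * fderiv ℝ (M.phi j) x (v x) := by
  rw [coef_eq_integral, restrict_domain_eq_restrict_space]
  refine setIntegral_eq_of_subset_of_ae_sdiff_eq_zero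
    isCompact_space.measurableSet.nullMeasurableSet (M.edgePatch_subset_space i j) ?_
  filter_upwards [exists_mem_interior_hull_ae] with x hx hxdiff
  obtain ⟨T, hT, hxT⟩ := hx hxdiff.1
  refine phi_mul_fderiv_phi_eq_zero hT hxT (fun hij => hxdiff.2 ?_) _
  exact mem_iUnion₂.2 ⟨T, ⟨hT, hij⟩, interior_subset hxT⟩

theorem coef_eq_zero_of_not_isEdge (v : Rd d → Rd d) (hij : i ≠ j) (h : ¬M.IsEdge i j) :
    M.coef v i j = 0 := by
  have hempty : M.edgePatch i j = ∅ := by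
    refine eq_empty_of_forall_notMem fun x hx => ?_
    obtain ⟨T, hT, -⟩ := mem_iUnion₂.1 hx
    exact h (isEdge_iff.2 ⟨hij, T, hT⟩)
  rw [coef_eq_setIntegral_edgePatch, hempty, setIntegral_empty]

theorem sum_fderiv_phi_ae :
    ∀ᵐ x ∂volume.restrict M.domain, ∑ j ∈ M.nodes, fderiv ℝ (M.phi j) x = 0 := by
  filter_upwards [exists_mem_interior_hull_ae_domain (M := M)] with x ⟨T, hT, hx⟩
  have hsum : (fun y => ∑ j ∈ M.nodes, M.phi j y) =ᶠ[𝓝 x] fun _ => 1 := by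
    filter_upwards [mem_interior_iff_mem_nhds.1 hx] with y hy
    exact sum_phi (hull_subset_space hT hy)
  rw [← fderiv_fun_sum fun j _ => (hasFDerivAt_phi hT hx j).differentiableAt, hsum.fderiv_eq,
    fderiv_const_apply]

theorem sum_coef_left (hv : IntegrableOn v M.domain) (k : Rd d) :
    ∑ i ∈ M.nodes, M.coef v i k = ∫ x in M.domain, fderiv ℝ (M.phi k) x (v x) := by
  simp only [coef_eq_integral]
  rw [← integral_finsetSum _ fun i _ => integrable_phi_mul_fderiv_phi hv i k]
  refine setIntegral_congr_fun isOpen_domain.measurableSet fun x hx => ?_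
  simp only [← Finset.sum_mul, sum_phi (domain_subset_space hx), one_mul]

theorem sum_coef_right (hv : IntegrableOn v M.domain) (k : Rd d) :
    ∑ j ∈ M.nodes, M.coef v k j = 0 := by
  simp only [coef_eq_integral]
  rw [← integral_finsetSum _ fun j _ => integrable_phi_mul_fderiv_phi hv k j]
  refine integral_eq_zero_of_ae ?_
  filter_upwards [sum_fderiv_phi_ae (M := M)] with x hx
  rw [← Finset.mul_sum, ← sum_apply, hx]
  simp

theorem hasDivMoments_pi2 [DecidableEq (Rd d)] {m : Rd d → Rd d → Rd d} (hm : M.IsChoice m)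
    (v : Rd d → Rd d) :
    M.HasDivMoments (M.Pi2 m v) (∑ i ∈ M.nodes, ∑ j ∈ M.nodes,
      (-M.coef v i j) • (Pi.single j (1 : ℝ) - Pi.single i (1 : ℝ))) := by
  classical
  have hedge (i : Rd d) (_ : i ∈ M.nodes) :
      ∑ j ∈ M.nodes, (-M.coef v i j) • (Pi.single j (1 : ℝ) - Pi.single i (1 : ℝ)) =
        ∑ j ∈ M.nodes with M.IsEdge i j,
          (-M.coef v i j) • (Pi.single j (1 : ℝ) - Pi.single i (1 : ℝ) : Rd d → ℝ) := by
    refine (Finset.sum_filter_of_ne fun j _ hne => not_not.1 fun hE => hne ?_).symm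
    by_cases hij : i = j
    · simp [hij]
    · simp [coef_eq_zero_of_not_isEdge v hij hE]
  rw [pi2_eq_sum, Finset.sum_congr rfl hedge]
  exact .sum fun i _ => .sum fun j hj =>
    ((Finset.mem_filter.1 hj).2.symm.hasDivMoments_psi hm).const_smul _

theorem exists_memW11_pi2 {m : Rd d → Rd d → Rd d} (hm : M.IsChoice m)
    {G : Rd d → Rd d →L[ℝ] Rd d} (hv : MemW110 M.domain v G) :
    ∃ H, MemW11 M.domain (M.Pi2 m v) H ∧
      ∀ k ∈ M.nodes, ∫ x in M.domain, divOf H x * M.phi k x =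
        ∫ x in M.domain, divOf G x * M.phi k x := by
  classical
  obtain ⟨H, hH, hmoments⟩ := hasDivMoments_pi2 hm v
  refine ⟨H, hH, fun k hk => ?_⟩
  calc ∫ x in M.domain, divOf H x * M.phi k x
    _ = ∑ j ∈ M.nodes, M.coef v k j - ∑ i ∈ M.nodes, M.coef v i k := by
      rw [hmoments k]
      simp [Finset.sum_apply, Pi.single_apply, mul_sub, Finset.sum_sub_distrib, hk]
    _ = -∫ x in M.domain, fderiv ℝ (M.phi k) x (v x) := by
      rw [sum_coef_left hv.integrable, sum_coef_right hv.integrable, zero_sub]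
    _ = ∫ x in M.domain, divOf G x * M.phi k x :=
      ((M.memW1Inf_phi k).integral_divOf_mul isOpen_domain hv).symm

end Coefficients

end Mesh

section ShapeRegular

variable {d : ℕ}

theorem IsSimplex.norm_baryGrad_le {T : Finset (Rd d)} (hT : IsSimplex T) {x : Rd d} {r : ℝ}
    (hr : 0 < r) (hball : Metric.closedBall x r ⊆ hull T) (k : Rd d) : ‖baryGrad T k‖ ≤ 1 / r := by
  refine ContinuousLinearMap.opNorm_bound_of_ball_bound hr 1 _ fun w hw => ?_
  have hx : x ∈ hull T := hball (Metric.mem_closedBall_self hr.le)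
  have hxw : x + w ∈ hull T := hball (by simpa using hw)
  have hdiff := bary_sub_bary T k (x + w) x
  rw [add_sub_cancel_left] at hdiff
  rw [← hdiff, Real.norm_eq_abs, abs_le]
  constructor <;> linarith [hT.bary_nonneg hx k, hT.bary_le_one hx k, hT.bary_nonneg hxw k,
    hT.bary_le_one hxw k]

theorem norm_sub_le_diam {T : Finset (Rd d)} {x y : Rd d} (hx : x ∈ hull T) (hy : y ∈ hull T) :
    ‖x - y‖ ≤ Metric.diam (hull T) := by
  rw [← dist_eq_norm]
  exact Metric.dist_le_diam_of_mem (isCompact_hull T).isBounded hx hy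

theorem IsSimplex.inradius_le_norm_sub {T : Finset (Rd d)} (hT : IsSimplex T) {x : Rd d} {r : ℝ}
    (hr : 0 < r) (hball : Metric.closedBall x r ⊆ hull T) {i j : Rd d} (hi : i ∈ T) (hj : j ∈ T)
    (hij : i ≠ j) : r ≤ ‖j - i‖ := by
  classical
  have h := (baryGrad T j).le_of_opNorm_le (hT.norm_baryGrad_le hr hball j) (j - i)
  rw [hT.baryGrad_sub hi hj, if_pos rfl, if_neg hij.symm, sub_zero, norm_one, one_div,
    ← div_eq_inv_mul, le_div_iff₀ hr, one_mul] at h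
  exact h

theorem IsSimplex.exists_mem_ne {T : Finset (Rd d)} (hT : IsSimplex T) (hd : 1 ≤ d) (i : Rd d) :
    ∃ j ∈ T, j ≠ i :=
  Finset.exists_mem_ne (by rw [hT.card]; omega) i

theorem IsSimplex.inradius_le_diam {T : Finset (Rd d)} (hT : IsSimplex T) (hd : 1 ≤ d) {x : Rd d}
    {r : ℝ} (hr : 0 < r) (hball : Metric.closedBall x r ⊆ hull T) : r ≤ Metric.diam (hull T) := by
  obtain ⟨i, hi⟩ : T.Nonempty := Finset.card_pos.1 (by rw [hT.card]; omega)
  obtain ⟨j, hj, hji⟩ := hT.exists_mem_ne hd i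
  exact (hT.inradius_le_norm_sub hr hball hi hj hji.symm).trans
    (norm_sub_le_diam (mem_hull hj) (mem_hull hi))

/-- A simplex contains its image under the homothety with ratio `t` centred at a vertex. -/
theorem pow_mul_volume_hull_le {T : Finset (Rd d)} {j : Rd d} (hj : j ∈ T) {t : ℝ} (ht0 : 0 ≤ t)
    (ht1 : t ≤ 1) :
    t ^ d * volume.real (hull T) ≤
      volume.real (hull T ∩ Metric.closedBall j (t * Metric.diam (hull T))) := by
  have himage : AffineMap.homothety j t '' hull T ⊆
      hull T ∩ Metric.closedBall j (t * Metric.diam (hull T)) := by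
    rintro _ ⟨x, hx, rfl⟩
    refine ⟨(convex_hull T).lineMap_mem (mem_hull hj) hx ⟨ht0, ht1⟩, ?_⟩
    rw [Metric.mem_closedBall, dist_homothety_center, Real.norm_of_nonneg ht0]
    gcongr
    exact Metric.dist_le_diam_of_mem (isCompact_hull T).isBounded (mem_hull hj) hx
  calc t ^ d * volume.real (hull T) = volume.real (AffineMap.homothety j t '' hull T) := by
        rw [Measure.real, Measure.real, Measure.addHaar_image_homothety, finrank_euclideanSpace_fin,
          ENNReal.toReal_mul, ENNReal.toReal_ofReal (abs_nonneg _), abs_of_nonneg (by positivity)]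
    _ ≤ _ := measureReal_mono himage
        (measure_ne_top_of_subset inter_subset_left (isCompact_hull T).measure_lt_top.ne)

namespace Mesh.ShapeRegular

variable {M : Mesh d} {κ : ℝ} (h : M.ShapeRegular κ) {T : Finset (Rd d)} (hT : T ∈ M.simplices)
include h hT

theorem nonneg : 0 ≤ κ := by
  obtain ⟨x, r, hr, -, hdiam⟩ := h T hT
  exact nonneg_of_mul_nonneg_left (Metric.diam_nonneg.trans hdiam) hr

theorem one_le (hd : 1 ≤ d) : 1 ≤ κ := by
  obtain ⟨x, r, hr, hball, hdiam⟩ := h T hT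
  have hrκ := ((isSimplex hT).inradius_le_diam hd hr hball).trans hdiam
  exact le_of_mul_le_mul_right (by rwa [one_mul]) hr

theorem diam_pos (hd : 1 ≤ d) : 0 < Metric.diam (hull T) := by
  obtain ⟨x, r, hr, hball, -⟩ := h T hT
  exact hr.trans_le ((isSimplex hT).inradius_le_diam hd hr hball)

theorem diam_le_mul_norm_sub {i j : Rd d} (hi : i ∈ T) (hj : j ∈ T) (hij : i ≠ j) :
    Metric.diam (hull T) ≤ κ * ‖j - i‖ := by
  obtain ⟨x, r, hr, hball, hdiam⟩ := h T hT
  refine hdiam.trans ?_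
  gcongr
  · exact h.nonneg hT
  · exact (isSimplex hT).inradius_le_norm_sub hr hball hi hj hij

theorem norm_baryGrad_le_div {i j : Rd d} (hi : i ∈ T) (hj : j ∈ T) (hij : i ≠ j) (k : Rd d) :
    ‖baryGrad T k‖ ≤ κ / ‖j - i‖ := by
  obtain ⟨x, r, hr, hball, hdiam⟩ := h T hT
  refine ((isSimplex hT).norm_baryGrad_le hr hball k).trans ?_
  rw [div_le_div_iff₀ hr (norm_pos_iff.2 (sub_ne_zero.2 hij.symm)), one_mul]
  exact (norm_sub_le_diam (mem_hull hj) (mem_hull hi)).trans hdiam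

theorem volume_closedBall_le (x₀ : Rd d) {c : ℝ} (hc : 0 ≤ c) :
    volume.real (Metric.closedBall x₀ (c * Metric.diam (hull T))) ≤
      (c * κ) ^ d * volume.real (hull T) := by
  obtain ⟨x, r, hr, hball, hdiam⟩ := h T hT
  have hκ := h.nonneg hT
  calc volume.real (Metric.closedBall x₀ (c * Metric.diam (hull T)))
      = (c * Metric.diam (hull T)) ^ d * volume.real (Metric.ball (0 : Rd d) 1) := by
        rw [Measure.addHaar_real_closedBall _ _ (mul_nonneg hc Metric.diam_nonneg),
          finrank_euclideanSpace_fin]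
    _ ≤ (c * (κ * r)) ^ d * volume.real (Metric.ball (0 : Rd d) 1) := by gcongr
    _ = (c * κ) ^ d * volume.real (Metric.closedBall x r) := by
        rw [Measure.addHaar_real_closedBall _ _ hr.le, finrank_euclideanSpace_fin]
        ring
    _ ≤ (c * κ) ^ d * volume.real (hull T) := by
        gcongr
        exact (isCompact_hull T).measure_lt_top.ne

theorem volume_closedBall_le_inter {j : Rd d} (hj : j ∈ T) {ρ : ℝ} (hρ : 0 ≤ ρ)
    (hρT : ρ ≤ Metric.diam (hull T)) :
    volume.real (Metric.closedBall j ρ) ≤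
      κ ^ d * volume.real (hull T ∩ Metric.closedBall j ρ) := by
  have hκ := h.nonneg hT
  rcases (hρ.trans hρT).eq_or_lt with hdiam | hdiam
  · obtain rfl : ρ = 0 := le_antisymm (hdiam ▸ hρT) hρ
    have hball := h.volume_closedBall_le hT j zero_le_one
    rw [← hdiam, mul_zero, one_mul] at hball
    have hinter := pow_mul_volume_hull_le hj zero_le_one le_rfl
    rw [← hdiam, mul_zero, one_pow, one_mul] at hinter
    exact hball.trans (by gcongr)
  have ht : 0 ≤ ρ / Metric.diam (hull T) := by positivity
  have hball := h.volume_closedBall_le hT j ht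
  have hinter := pow_mul_volume_hull_le hj ht ((div_le_one hdiam).2 hρT)
  rw [div_mul_cancel₀ _ hdiam.ne'] at hball hinter
  calc volume.real (Metric.closedBall j ρ)
      ≤ κ ^ d * ((ρ / Metric.diam (hull T)) ^ d * volume.real (hull T)) := by
        rwa [← mul_assoc, ← mul_pow, mul_comm κ]
    _ ≤ κ ^ d * volume.real (hull T ∩ Metric.closedBall j ρ) := by gcongr

end Mesh.ShapeRegular

end ShapeRegular

section Star

namespace Mesh

variable {d : ℕ} {M : Mesh d} {κ : ℝ} {j : Rd d}

open Classical in
/-- The simplices with the vertex `j`. -/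
def star (M : Mesh d) (j : Rd d) : Finset (Finset (Rd d)) :=
  M.elements.filter fun T => j ∈ T

theorem mem_star {T : Finset (Rd d)} : T ∈ M.star j ↔ T ∈ M.simplices ∧ j ∈ T := by
  simp [star, mem_elements]

theorem sum_volume_hull_inter_le {S : Finset (Finset (Rd d))} (hS : S ⊆ M.elements)
    {P : Set (Rd d)} (hP : MeasurableSet P) (hfin : volume P ≠ ⊤) :
    ∑ T ∈ S, volume.real (hull T ∩ P) ≤ volume.real P := by
  have : IsFiniteMeasure (volume.restrict P) := isFiniteMeasure_restrict.2 hfin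
  simp only [← measureReal_restrict_apply' hP]
  rw [← measureReal_biUnion_finset₀
    (fun T hT T' hT' hne => Measure.absolutelyContinuous_of_le Measure.restrict_le_self
      (aedisjoint_hull (mem_elements.1 (hS hT)) (mem_elements.1 (hS hT')) hne))
    fun T _ => (isClosed_hull T).measurableSet.nullMeasurableSet]
  simpa using measureReal_mono (μ := volume.restrict P) (subset_univ (⋃ T ∈ S, hull T))

/-- All simplices at `j` occupy a fixed fraction of the ball around `j` whose radius is their
smallest diameter. -/
theorem ShapeRegular.card_star_le (h : M.ShapeRegular κ) (hd : 1 ≤ d)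
    (hj : (M.star j).Nonempty) : ((M.star j).card : ℝ) ≤ κ ^ d := by
  obtain ⟨T₀, hT₀, hmin⟩ := (M.star j).exists_min_image (fun T => Metric.diam (hull T)) hj
  set ρ := Metric.diam (hull T₀)
  have hρ : 0 < ρ := h.diam_pos (mem_star.1 hT₀).1 hd
  have hfin : volume (Metric.closedBall j ρ) ≠ ⊤ := (isCompact_closedBall j ρ).measure_lt_top.ne
  have hvol : 0 < volume.real (Metric.closedBall j ρ) :=
    ENNReal.toReal_pos (Metric.measure_closedBall_pos _ _ hρ).ne' hfin
  refine le_of_mul_le_mul_right ?_ hvol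
  calc ((M.star j).card : ℝ) * volume.real (Metric.closedBall j ρ)
      ≤ ∑ T ∈ M.star j, κ ^ d * volume.real (hull T ∩ Metric.closedBall j ρ) := by
        rw [← nsmul_eq_mul]
        exact Finset.card_nsmul_le_sum _ _ _ fun T hT =>
          h.volume_closedBall_le_inter (mem_star.1 hT).1 (mem_star.1 hT).2 hρ.le (hmin T hT)
    _ ≤ κ ^ d * volume.real (Metric.closedBall j ρ) := by
        rw [← Finset.mul_sum]
        have := h.nonneg (mem_star.1 hT₀).1
        gcongr
        exact sum_volume_hull_inter_le (Finset.filter_subset _ _) measurableSet_closedBall hfin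

theorem eventually_mem_biUnion_star (hj : j ∈ M.nodes) :
    ∀ᶠ x in 𝓝 j, x ∈ M.complex.space → x ∈ ⋃ T ∈ M.star j, hull T := by
  classical
  have hclosed : IsClosed (⋃ T ∈ M.elements \ M.star j, hull T) :=
    (M.elements \ M.star j).finite_toSet.isClosed_biUnion fun T _ => isClosed_hull T
  have hmem : j ∉ ⋃ T ∈ M.elements \ M.star j, hull T := by
    simp only [mem_iUnion₂, Finset.mem_sdiff, mem_elements, mem_star, not_exists, not_and, and_imp]
    exact fun T hT hnot hjT => hnot hT (mem_of_mem_hull hj hT hjT)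
  filter_upwards [hclosed.isOpen_compl.mem_nhds hmem] with x hx hspace
  obtain ⟨T, hT, hxT⟩ := exists_mem_hull hspace
  by_contra hstar
  exact hx (mem_biUnion (Finset.mem_sdiff.2 ⟨mem_elements.2 hT,
    fun hTs => hstar (mem_biUnion hTs hxT)⟩) hxT)

theorem exists_mem_ne_of_isPreconnected {S : Set (Rd d)} (hS : IsPreconnected S) (hjS : j ∉ S)
    (hcover : S ⊆ ⋃ T ∈ M.star j, hull T) (hmeet : ∀ T ∈ M.star j, (S ∩ hull T).Nonempty)
    {A : Finset (Finset (Rd d))} (hA : A ⊆ M.star j) (hne : A.Nonempty) (hAs : A ≠ M.star j) :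
    ∃ T₁ ∈ A, ∃ T₂ ∈ M.star j, T₂ ∉ A ∧ ∃ k, k ≠ j ∧ k ∈ T₁ ∧ k ∈ T₂ := by
  obtain ⟨T₁, hT₁⟩ := hne
  obtain ⟨T₂, hT₂, hT₂A⟩ := Finset.exists_of_ssubset (hA.ssubset_of_ne hAs)
  have hclosed (B : Set (Finset (Rd d))) (hB : B ⊆ M.star j) : IsClosed (⋃ T ∈ B, hull T) :=
    ((M.star j).finite_toSet.subset hB).isClosed_biUnion fun T _ => isClosed_hull T
  obtain ⟨x, hxS, hxA, hxB⟩ := isPreconnected_closed_iff.1 hS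
    (⋃ T ∈ (A : Set (Finset (Rd d))), hull T)
    (⋃ T ∈ (M.star j : Set (Finset (Rd d))) \ A, hull T) (hclosed _ (mod_cast hA))
    (hclosed _ sdiff_subset)
    (hcover.trans (by rw [← biUnion_union, union_sdiff_cancel (mod_cast hA)]; rfl))
    ((hmeet T₁ (hA hT₁)).mono (inter_subset_inter_right _ (subset_biUnion_of_mem hT₁)))
    ((hmeet T₂ hT₂).mono (inter_subset_inter_right _
      (subset_biUnion_of_mem (u := hull) ⟨hT₂, hT₂A⟩)))
  obtain ⟨T₁, hT₁, hx₁⟩ := mem_iUnion₂.1 hxA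
  obtain ⟨T₂, ⟨hT₂, hT₂A⟩, hx₂⟩ := mem_iUnion₂.1 hxB
  refine ⟨T₁, hT₁, T₂, hT₂, hT₂A, ?_⟩
  by_contra! hcommon
  have hx := M.complex.inter_subset_convexHull (mem_star.1 (hA hT₁)).1.1 (mem_star.1 hT₂).1.1
    ⟨hx₁, hx₂⟩
  have hsub : (T₁ ∩ T₂ : Set (Rd d)) ⊆ {j} := fun k hk =>
    by_contra fun hkj => hcommon k hkj hk.1 hk.2
  have hxj : x = j := by simpa using convexHull_mono hsub hx
  exact hjS (hxj ▸ hxS)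

theorem sphere_inter_hull_nonempty {T : Finset (Rd d)} (hj : j ∈ T) {k : Rd d} (hk : k ∈ T)
    {ρ : ℝ} (hρ : 0 ≤ ρ) (hρk : ρ ≤ dist k j) : (Metric.sphere j ρ ∩ hull T).Nonempty := by
  obtain ⟨x, hx, hxρ⟩ := (convex_hull T).isPreconnected.intermediate_value (mem_hull hj)
    (mem_hull hk) (f := fun x => dist x j) (by fun_prop) ⟨by simpa using hρ, hρk⟩
  exact ⟨x, hxρ, hx⟩

theorem exists_isPreconnected_of_mem_domain (hd : 2 ≤ d) (hj : j ∈ M.domain) {U : Set (Rd d)}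
    (hU : U ∈ 𝓝 j) : ∃ S ⊆ U ∩ M.complex.space, IsPreconnected S ∧ j ∉ S ∧
      ∀ T ∈ M.star j, (S ∩ hull T).Nonempty := by
  have hsmall : ∀ᶠ ρ in 𝓝[>] (0 : ℝ), Metric.sphere j ρ ⊆ U ∩ M.domain := by
    obtain ⟨ε, hε, hball⟩ := Metric.mem_nhds_iff.1 (inter_mem hU (isOpen_domain.mem_nhds hj))
    filter_upwards [Ioo_mem_nhdsGT hε] with ρ hρ x hx
    exact hball ((Metric.mem_sphere.1 hx).trans_lt hρ.2)
  have hmeet : ∀ᶠ ρ in 𝓝[>] (0 : ℝ), ∀ T ∈ M.star j, (Metric.sphere j ρ ∩ hull T).Nonempty := by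
    refine (Finset.eventually_all _).2 fun T hT => ?_
    obtain ⟨hT, hjT⟩ := mem_star.1 hT
    obtain ⟨k, hk, hkj⟩ := (isSimplex hT).exists_mem_ne (by omega) j
    filter_upwards [Ioc_mem_nhdsGT (dist_pos.2 hkj)] with ρ hρ
    exact sphere_inter_hull_nonempty hjT hk hρ.1.le hρ.2
  obtain ⟨ρ, ⟨hsmall, hmeet⟩, hρ⟩ := ((hsmall.and hmeet).and self_mem_nhdsWithin).exists
  have hrank : 1 < Module.rank ℝ (Rd d) := by
    rw [← Module.finrank_eq_rank, finrank_euclideanSpace_fin]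
    exact_mod_cast hd
  refine ⟨Metric.sphere j ρ, hsmall.trans (inter_subset_inter_right _ domain_subset_space),
    isPreconnected_sphere hrank j ρ, fun hmem => ?_, hmeet⟩
  rw [Metric.mem_sphere, dist_self] at hmem
  exact hρ.ne hmem

theorem hull_subset_closure_interior {T : Finset (Rd d)} (hT : IsSimplex T) :
    hull T ⊆ closure (interior (hull T)) := by
  rw [(convex_hull T).closure_interior_eq_closure_of_nonempty_interior hT.interior_hull_nonempty]
  exact subset_closure

theorem BoundaryLocallyConnected.exists_isPreconnected (hB : M.BoundaryLocallyConnected)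
    (hj : j ∈ M.nodes) (hjd : j ∉ M.domain) {U : Set (Rd d)} (hU : U ∈ 𝓝 j) :
    ∃ S ⊆ U ∩ M.complex.space, IsPreconnected S ∧ j ∉ S ∧
      ∀ T ∈ M.star j, (S ∩ hull T).Nonempty := by
  have hclosure : ∀ T ∈ M.simplices, j ∈ T → j ∈ closure (interior (hull T)) := fun T hT hjT =>
    hull_subset_closure_interior (isSimplex hT) (mem_hull hjT)
  have hfrontier : j ∈ frontier M.domain := by
    obtain ⟨T, hT, hjT⟩ := mem_nodes_iff.1 hj
    rw [isOpen_domain.frontier_eq]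
    exact ⟨closure_mono (interior_hull_subset_domain hT) (hclosure T hT hjT), hjd⟩
  obtain ⟨V, hV, hVU, hVc⟩ := hB j hfrontier U hU
  refine ⟨V ∩ M.domain, inter_subset_inter hVU domain_subset_space, hVc, fun hmem => hjd hmem.2,
    fun T hT => ?_⟩
  obtain ⟨hT, hjT⟩ := mem_star.1 hT
  obtain ⟨x, hxV, hxT⟩ := mem_closure_iff_nhds.1 (hclosure T hT hjT) V hV
  exact ⟨x, ⟨hxV, interior_hull_subset_domain hT hxT⟩, interior_subset hxT⟩

theorem BoundaryLocallyConnected.exists_mem_ne (hB : M.BoundaryLocallyConnected) (hd : 2 ≤ d)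
    {A : Finset (Finset (Rd d))} (hA : A ⊆ M.star j) (hne : A.Nonempty) (hAs : A ≠ M.star j) :
    ∃ T₁ ∈ A, ∃ T₂ ∈ M.star j, T₂ ∉ A ∧ ∃ k, k ≠ j ∧ k ∈ T₁ ∧ k ∈ T₂ := by
  have hj : j ∈ M.nodes := by
    obtain ⟨T, hT⟩ := hne
    exact mem_nodes_iff.2 ⟨T, mem_star.1 (hA hT)⟩
  obtain ⟨S, hSU, hS, hjS, hmeet⟩ : ∃ S ⊆ {x | x ∈ M.complex.space → x ∈ ⋃ T ∈ M.star j, hull T} ∩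
      M.complex.space, IsPreconnected S ∧ j ∉ S ∧ ∀ T ∈ M.star j, (S ∩ hull T).Nonempty := by
    by_cases hjd : j ∈ M.domain
    · exact exists_isPreconnected_of_mem_domain hd hjd (eventually_mem_biUnion_star hj)
    · exact hB.exists_isPreconnected hj hjd (eventually_mem_biUnion_star hj)
  exact exists_mem_ne_of_isPreconnected hS hjS (fun x hx => (hSU hx).1 (hSU hx).2) hmeet hA hne hAs

end Mesh

theorem eq_of_forall_ssubset_succ {α : Type*} {s : Finset α} {A : ℕ → Finset α}
    (hA : ∀ n, A n ⊆ s) (hmono : Monotone A) (hgrow : ∀ n, A n ≠ s → A n ⊂ A (n + 1)) {n : ℕ}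
    (hn : s.card ≤ n) : A n = s := by
  by_contra hne
  have hcard : ∀ k ≤ n, k ≤ (A k).card := by
    intro k hk
    induction k with
    | zero => exact Nat.zero_le _
    | succ k ih =>
      have hks : A k ≠ s := fun hks => hne ((hA n).antisymm (hks ▸ hmono (by omega)))
      exact (ih (by omega)).trans_lt (Finset.card_lt_card (hgrow k hks))
  have := Finset.card_lt_card ((hA n).ssubset_of_ne hne)
  have := hcard n le_rfl
  omega

namespace Mesh

variable {d : ℕ} {M : Mesh d} {κ : ℝ} {j : Rd d}

/-- The bound for the ratio of the diameters of two simplices with a common vertex: such simplices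
are joined by a chain of at most `κᵈ` simplices, consecutive ones sharing an edge. -/
def diamRatio (d : ℕ) (κ : ℝ) : ℝ := κ ^ ⌈κ ^ d⌉₊

theorem ShapeRegular.diam_le_of_mem_of_mem (h : M.ShapeRegular κ) {T T' : Finset (Rd d)}
    (hT : T ∈ M.simplices) (hT' : T' ∈ M.simplices) {i j : Rd d} (hij : i ≠ j) (hi : i ∈ T)
    (hj : j ∈ T) (hi' : i ∈ T') (hj' : j ∈ T') :
    Metric.diam (hull T') ≤ κ * Metric.diam (hull T) := by
  refine (h.diam_le_mul_norm_sub hT' hi' hj' hij).trans ?_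
  gcongr
  · exact h.nonneg hT
  · exact norm_sub_le_diam (mem_hull hj) (mem_hull hi)

theorem ShapeRegular.diam_le_of_mem_star (h : M.ShapeRegular κ) (hd : 2 ≤ d)
    (hB : M.BoundaryLocallyConnected) {T T' : Finset (Rd d)} (hT : T ∈ M.star j)
    (hT' : T' ∈ M.star j) :
    Metric.diam (hull T') ≤ diamRatio d κ * Metric.diam (hull T) := by
  have hκ := h.one_le (mem_star.1 hT).1 (by omega)
  let A (n : ℕ) : Finset (Finset (Rd d)) :=
    {S ∈ M.star j | Metric.diam (hull S) ≤ κ ^ n * Metric.diam (hull T)}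
  have hA (n : ℕ) : A n ⊆ M.star j := Finset.filter_subset _ _
  have hmono : Monotone A := fun m n hmn => Finset.monotone_filter_right _ fun S _ hS =>
    hS.trans (by gcongr)
  have hgrow (n : ℕ) (hn : A n ≠ M.star j) : A n ⊂ A (n + 1) := by
    have hTn : T ∈ A n := hmono (Nat.zero_le n) (Finset.mem_filter.2 ⟨hT, by simp⟩)
    obtain ⟨T₁, hT₁, T₂, hT₂, hT₂n, k, hkj, hk₁, hk₂⟩ := hB.exists_mem_ne hd (hA n) ⟨T, hTn⟩ hn
    obtain ⟨hT₁s, hT₁n⟩ := Finset.mem_filter.1 hT₁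
    refine (Finset.ssubset_iff_of_subset (hmono n.le_succ)).2
      ⟨T₂, Finset.mem_filter.2 ⟨hT₂, ?_⟩, hT₂n⟩
    calc Metric.diam (hull T₂) ≤ κ * Metric.diam (hull T₁) :=
          h.diam_le_of_mem_of_mem (mem_star.1 hT₁s).1 (mem_star.1 hT₂).1 hkj hk₁
            (mem_star.1 hT₁s).2 hk₂ (mem_star.1 hT₂).2
      _ ≤ κ * (κ ^ n * Metric.diam (hull T)) := by gcongr
      _ = κ ^ (n + 1) * Metric.diam (hull T) := by ring
  have hcard : (M.star j).card ≤ ⌈κ ^ d⌉₊ :=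
    mod_cast (h.card_star_le (by omega) ⟨T, hT⟩).trans (Nat.le_ceil _)
  rw [← eq_of_forall_ssubset_succ hA hmono hgrow hcard] at hT'
  exact (Finset.mem_filter.1 hT').2

end Mesh

end Star

namespace Mesh

variable {d : ℕ} {M : Mesh d} {κ Q : ℝ} {i j x : Rd d} {T : Finset (Rd d)} {P : Set (Rd d)}
  {v : Rd d → Rd d} {m : Rd d → Rd d → Rd d}

theorem integrableOn_space (hv : IntegrableOn v M.domain) : IntegrableOn v M.complex.space := by
  rwa [IntegrableOn, ← restrict_domain_eq_restrict_space]

theorem ShapeRegular.norm_phi_mul_fderiv_phi_le (h : M.ShapeRegular κ) (hij : i ≠ j)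
    (hT : T ∈ M.simplices) (hx : x ∈ interior (hull T)) (w : Rd d) :
    ‖M.phi i x * fderiv ℝ (M.phi j) x w‖ ≤ κ / ‖j - i‖ * ‖w‖ := by
  have hκ := h.nonneg hT
  by_cases hmem : i ∈ T ∧ j ∈ T
  · rw [(hasFDerivAt_phi hT hx j).fderiv, norm_mul, ← one_mul (κ / ‖j - i‖ * ‖w‖)]
    gcongr
    · exact abs_phi_le_one (hull_subset_space hT (interior_subset hx)) i
    · exact (baryGrad T j).le_of_opNorm_le (h.norm_baryGrad_le_div hT hmem.1 hmem.2 hij j) w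
  · rw [phi_mul_fderiv_phi_eq_zero hT hx hmem, norm_zero]
    positivity

theorem ShapeRegular.abs_coef_le (h : M.ShapeRegular κ) (hv : IntegrableOn v M.domain)
    (hij : i ≠ j) : |M.coef v i j| ≤ κ / ‖j - i‖ * ∫ x in M.edgePatch i j, ‖v x‖ := by
  have hsub := M.edgePatch_subset_space i j
  rw [coef_eq_setIntegral_edgePatch, ← Real.norm_eq_abs, ← integral_const_mul]
  refine norm_integral_le_of_norm_le
    (((integrableOn_space hv).mono_set hsub).norm.const_mul _)
    (ae_restrict_of_ae_restrict_of_subset hsub ?_)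
  rw [← restrict_domain_eq_restrict_space]
  filter_upwards [exists_mem_interior_hull_ae_domain (M := M)] with x ⟨T, hT, hx⟩
  exact h.norm_phi_mul_fderiv_phi_le hij hT hx (v x)

theorem b_eq_zero (hT : T ∈ M.simplices) (hx : x ∈ hull T) (h : ¬(i ∈ T ∧ j ∈ T)) :
    M.b i j x = 0 := by
  rw [b, Pi.smul_apply, bubble, phi_eq_bary hT hx, phi_eq_bary hT hx]
  rcases not_and_or.1 h with hi | hj
  · simp [bary_of_notMem hi]
  · simp [bary_of_notMem hj]

theorem norm_b_le (hT : T ∈ M.simplices) (hx : x ∈ hull T) (i j : Rd d) :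
    ‖M.b i j x‖ ≤ (d + 1) * (d + 2) / volume.real (hull T) * Metric.diam (hull T) := by
  have hvol := (isSimplex hT).volume_hull_pos
  by_cases h : i ∈ T ∧ j ∈ T
  · have hphi := abs_phi_le_one (hull_subset_space hT hx)
    have hbubble : ‖M.bubble i j x‖ ≤ Metric.diam (hull T) := by
      rw [bubble, norm_smul, norm_mul]
      exact (mul_le_of_le_one_left (norm_nonneg _)
        (mul_le_one₀ (hphi i) (norm_nonneg _) (hphi j))).trans
        (norm_sub_le_diam (mem_hull h.2) (mem_hull h.1))
    rw [b_eq_smul_bubble, Pi.smul_apply, norm_smul, Real.norm_of_nonneg (by positivity)]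
    exact mul_le_mul (div_le_div_of_nonneg_left (by positivity) hvol
      (volume_hull_le_edgePatch hT h.1 h.2)) hbubble (norm_nonneg _) (by positivity)
  · rw [b_eq_zero hT hx h, norm_zero]
    exact mul_nonneg (by positivity) Metric.diam_nonneg

theorem psi_eq_zero (hT : T ∈ M.simplices) (hx : x ∈ hull T) (hi : i ∉ T) (hj : j ∉ T) :
    M.psi m i j x = 0 := by
  rw [psi]
  split_ifs
  · rw [Pi.add_apply, b_eq_zero hT hx fun h => hi h.1, b_eq_zero hT hx fun h => hj h.2, add_zero]
  · exact b_eq_zero hT hx fun h => hi h.1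

theorem norm_psi_le (m : Rd d → Rd d → Rd d) (hT : T ∈ M.simplices) (hx : x ∈ hull T)
    (i j : Rd d) :
    ‖M.psi m i j x‖ ≤
      2 * ((d + 1) * (d + 2) / volume.real (hull T) * Metric.diam (hull T)) := by
  have hb := norm_b_le hT hx
  rw [psi, two_mul]
  split_ifs
  · exact (norm_add_le _ _).trans (add_le_add (hb _ _) (hb _ _))
  · exact (hb i j).trans (le_add_of_nonneg_left ((norm_nonneg _).trans (hb i j)))

section EdgesAt

open Classical in
/-- The edges with an endpoint in `T`, each in both orientations. They index the summands of `Π₂ v`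
that do not vanish on `T`. -/
def edgesAt (M : Mesh d) (T : Finset (Rd d)) : Finset (Rd d × Rd d) :=
  {p ∈ M.nodes ×ˢ M.nodes | M.IsEdge p.1 p.2 ∧ (p.1 ∈ T ∨ p.2 ∈ T)}

theorem isEdge_of_mem_edgesAt {p : Rd d × Rd d} (hp : p ∈ M.edgesAt T) : M.IsEdge p.1 p.2 := by
  classical exact (Finset.mem_filter.1 hp).2.1

theorem mem_or_mem_of_mem_edgesAt {p : Rd d × Rd d} (hp : p ∈ M.edgesAt T) :
    p.1 ∈ T ∨ p.2 ∈ T := by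
  classical exact (Finset.mem_filter.1 hp).2.2

theorem pi2_apply_eq_sum_edgesAt (m : Rd d → Rd d → Rd d) (v : Rd d → Rd d)
    (hT : T ∈ M.simplices) (hx : x ∈ hull T) :
    M.Pi2 m v x = ∑ p ∈ M.edgesAt T, (-M.coef v p.1 p.2) • M.psi m p.2 p.1 x := by
  classical
  simp only [pi2_eq_sum, Finset.sum_apply, Pi.smul_apply]
  simp only [edgesAt, Finset.sum_filter]
  rw [← Finset.sum_product']
  refine Finset.sum_congr rfl fun p _ => ?_
  by_cases hp : p.1 ∈ T ∨ p.2 ∈ T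
  · simp only [hp, and_true]
  · rw [not_or] at hp
    simp [psi_eq_zero hT hx hp.2 hp.1]

theorem ShapeRegular.card_edgesAt_le (h : M.ShapeRegular κ) (hd : 1 ≤ d)
    (hT : T ∈ M.simplices) :
    ((M.edgesAt T).card : ℝ) ≤ 2 * (d + 1) ^ 2 * κ ^ d := by
  classical
  have hsub : M.edgesAt T ⊆ T.biUnion fun i => (M.star i).biUnion fun S =>
      S.image (i, ·) ∪ S.image (·, i) := by
    intro p hp
    obtain ⟨-, S, hS, h1, h2⟩ := isEdge_iff.1 (isEdge_of_mem_edgesAt hp)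
    simp only [Finset.mem_biUnion, Finset.mem_union, Finset.mem_image, mem_star]
    rcases mem_or_mem_of_mem_edgesAt hp with hpT | hpT
    · exact ⟨p.1, hpT, S, ⟨hS, h1⟩, .inl ⟨p.2, h2, rfl⟩⟩
    · exact ⟨p.2, hpT, S, ⟨hS, h2⟩, .inr ⟨p.1, h1, rfl⟩⟩
  have himages (i : Rd d) (S : Finset (Rd d)) (hS : S ∈ M.star i) :
      (S.image (i, ·) ∪ S.image (·, i)).card ≤ 2 * (d + 1) := by
    rw [two_mul, ← (isSimplex (mem_star.1 hS).1).card]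
    exact (Finset.card_union_le _ _).trans
      (add_le_add Finset.card_image_le Finset.card_image_le)
  have hcard : (M.edgesAt T).card ≤ ∑ i ∈ T, (M.star i).card * (2 * (d + 1)) :=
    (Finset.card_le_card hsub).trans <| Finset.card_biUnion_le.trans <|
      Finset.sum_le_sum fun i _ => Finset.card_biUnion_le_card_mul _ _ _ (himages i)
  calc ((M.edgesAt T).card : ℝ) ≤ ∑ i ∈ T, ((M.star i).card : ℝ) * (2 * (d + 1)) := mod_cast hcard
    _ ≤ ∑ i ∈ T, κ ^ d * (2 * (d + 1)) := by
      gcongr with i hi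
      exact h.card_star_le hd ⟨T, mem_star.2 ⟨hT, hi⟩⟩
    _ = 2 * (d + 1) ^ 2 * κ ^ d := by
      rw [Finset.sum_const, (isSimplex hT).card, nsmul_eq_mul]
      push_cast
      ring

end EdgesAt

/-- `P` is covered by simplices that meet `T` in a vertex and whose diameter is at most `Q` times
that of `T`. This is what the stability estimate uses of `ω₀(T)` and `ω₁(T)`. -/
def IsPatch (M : Mesh d) (Q : ℝ) (T : Finset (Rd d)) (P : Set (Rd d)) : Prop :=
  ∀ y ∈ P, ∃ T' ∈ M.simplices, y ∈ hull T' ∧ (∃ k ∈ T, k ∈ T') ∧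
    Metric.diam (hull T') ≤ Q * Metric.diam (hull T)

namespace IsPatch

theorem subset_space (hP : M.IsPatch Q T P) : P ⊆ M.complex.space := fun y hy => by
  obtain ⟨T', hT', hyT', -⟩ := hP y hy
  exact hull_subset_space hT' hyT'

theorem volume_ne_top (hP : M.IsPatch Q T P) : volume P ≠ ⊤ :=
  measure_ne_top_of_subset hP.subset_space isCompact_space.measure_ne_top

theorem volume_le (hP : M.IsPatch Q T P) (h : M.ShapeRegular κ) (hT : T ∈ M.simplices)
    (hQ : 0 ≤ Q) : volume.real P ≤ ((1 + Q) * κ) ^ d * volume.real (hull T) := by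
  obtain ⟨x₀, hx₀⟩ : T.Nonempty := Finset.card_pos.1 (by rw [(isSimplex hT).card]; omega)
  have hball : P ⊆ Metric.closedBall x₀ ((1 + Q) * Metric.diam (hull T)) := by
    intro y hy
    obtain ⟨T', -, hyT', ⟨k, hk, hk'⟩, hdiam⟩ := hP y hy
    rw [mem_closedBall_iff_norm]
    calc ‖y - x₀‖ ≤ ‖y - k‖ + ‖k - x₀‖ := norm_sub_le_norm_sub_add_norm_sub _ _ _
      _ ≤ Metric.diam (hull T') + Metric.diam (hull T) :=
        add_le_add (norm_sub_le_diam hyT' (mem_hull hk'))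
          (norm_sub_le_diam (mem_hull hk) (mem_hull hx₀))
      _ ≤ (1 + Q) * Metric.diam (hull T) := by linarith
  exact (measureReal_mono hball measure_closedBall_lt_top.ne).trans
    (h.volume_closedBall_le hT x₀ (by positivity))

theorem setIntegral_norm_le (hP : M.IsPatch Q T P) (h : M.ShapeRegular κ) (hT : T ∈ M.simplices)
    (hQ : 0 ≤ Q) (v : Rd d → Rd d) :
    ∫ y in P, ‖v y‖ ≤ ((1 + Q) * κ) ^ d * volume.real (hull T) * ⨍ y in P, ‖v y‖ := by
  rw [← measure_smul_setAverage _ hP.volume_ne_top, smul_eq_mul]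
  exact mul_le_mul_of_nonneg_right (hP.volume_le h hT hQ)
    (integral_nonneg fun _ => norm_nonneg _)

end IsPatch

/-- The product of the bounds for the number of edges at a simplex, for a single summand of `Π₂ v`,
and for the volume of the patch relative to that of the simplex. -/
def stabilityConst (d : ℕ) (κ Q : ℝ) : ℝ :=
  2 * (d + 1) ^ 2 * κ ^ d * (2 * (d + 1) * (d + 2) * κ * (Q * κ)) * ((1 + Q) * κ) ^ d

theorem ShapeRegular.norm_coef_smul_psi_le (h : M.ShapeRegular κ) (m : Rd d → Rd d → Rd d)
    (hv : IntegrableOn v M.domain) (hT : T ∈ M.simplices) (hx : x ∈ hull T) (hij : i ≠ j)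
    (hP : M.IsPatch Q T P) (hsub : M.edgePatch i j ⊆ P) {R : ℝ}
    (hdiam : Metric.diam (hull T) ≤ R * ‖j - i‖) :
    ‖(-M.coef v i j) • M.psi m j i x‖ ≤
      2 * (d + 1) * (d + 2) * κ * R / volume.real (hull T) * ∫ y in P, ‖v y‖ := by
  have hκ := h.nonneg hT
  have hvol := (isSimplex hT).volume_hull_pos
  have hlength : 0 < ‖j - i‖ := norm_pos_iff.2 (sub_ne_zero.2 hij.symm)
  have hmono : ∫ y in M.edgePatch i j, ‖v y‖ ≤ ∫ y in P, ‖v y‖ :=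
    setIntegral_mono_set ((integrableOn_space hv).mono_set hP.subset_space).norm
      (ae_of_all _ fun _ => norm_nonneg _) hsub.eventuallyLE
  have hintegral : 0 ≤ ∫ y in P, ‖v y‖ := integral_nonneg fun _ => norm_nonneg _
  have hcoef : |M.coef v i j| ≤ κ / ‖j - i‖ * ∫ y in P, ‖v y‖ :=
    (h.abs_coef_le hv hij).trans (mul_le_mul_of_nonneg_left hmono (by positivity))
  have hpsi : ‖M.psi m j i x‖ ≤
      2 * ((d + 1) * (d + 2) / volume.real (hull T) * (R * ‖j - i‖)) :=
    (norm_psi_le m hT hx j i).trans (by gcongr)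
  rw [norm_smul, norm_neg, Real.norm_eq_abs]
  refine (mul_le_mul hcoef hpsi (norm_nonneg _)
    (mul_nonneg (by positivity) hintegral)).trans_eq ?_
  field_simp

theorem ShapeRegular.eLpNorm_pi2_le (h : M.ShapeRegular κ) (hd : 1 ≤ d)
    (hv : IntegrableOn v M.domain) (hT : T ∈ M.simplices) (hQ : 0 ≤ Q) (hP : M.IsPatch Q T P)
    (hedges : ∀ i j, M.IsEdge i j → i ∈ T ∨ j ∈ T → (∀ x ∈ hull T, M.psi m j i x = 0) ∨
      M.edgePatch i j ⊆ P ∧ Metric.diam (hull T) ≤ Q * κ * ‖j - i‖) :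
    eLpNorm (M.Pi2 m v) ⊤ (volume.restrict (hull T)) ≤
      ENNReal.ofReal (stabilityConst d κ Q * ⨍ x in P, ‖v x‖) := by
  have hκ := h.nonneg hT
  have hvol := (isSimplex hT).volume_hull_pos
  set D := 2 * (d + 1) * (d + 2) * κ * (Q * κ) / volume.real (hull T) * ∫ y in P, ‖v y‖ with hD
  have hD0 : 0 ≤ D := mul_nonneg (by positivity) (integral_nonneg fun _ => norm_nonneg _)
  have hsummand (x : Rd d) (hx : x ∈ hull T) (p : Rd d × Rd d) (hp : p ∈ M.edgesAt T) :
      ‖(-M.coef v p.1 p.2) • M.psi m p.2 p.1 x‖ ≤ D := by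
    have hedge := isEdge_of_mem_edgesAt hp
    rcases hedges p.1 p.2 hedge (mem_or_mem_of_mem_edgesAt hp) with hzero | ⟨hsub, hdiam⟩
    · simpa [hzero x hx] using hD0
    · exact h.norm_coef_smul_psi_le m hv hT hx hedge.ne hP hsub hdiam
  rw [eLpNorm_exponent_top]
  refine eLpNormEssSup_le_of_ae_bound
    (ae_restrict_of_forall_mem (isClosed_hull T).measurableSet fun x hx => ?_)
  calc ‖M.Pi2 m v x‖ ≤ (M.edgesAt T).card * D := by
        rw [pi2_apply_eq_sum_edgesAt m v hT hx, ← nsmul_eq_mul]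
        exact (norm_sum_le _ _).trans (Finset.sum_le_card_nsmul _ _ _ (hsummand x hx))
    _ ≤ 2 * (d + 1) ^ 2 * κ ^ d * (2 * (d + 1) * (d + 2) * κ * (Q * κ) / volume.real (hull T) *
        (((1 + Q) * κ) ^ d * volume.real (hull T) * ⨍ y in P, ‖v y‖)) := by
      rw [hD]
      gcongr
      · exact h.card_edgesAt_le hd hT
      · exact hP.setIntegral_norm_le h hT hQ v
    _ = stabilityConst d κ Q * ⨍ y in P, ‖v y‖ := by
      rw [stabilityConst]
      field_simp

section NodalPatch

variable {T' : Finset (Rd d)} {k : Rd d}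

theorem hull_subset_omega0 (hT : T ∈ M.simplices) (hT' : T' ∈ M.simplices) (hk : k ∈ T)
    (hk' : k ∈ T') : hull T' ⊆ M.omega0 (hull T) :=
  subset_biUnion_of_mem (u := hull)
    (show T' ∈ {S ∈ M.simplices | ∃ j ∈ M.nodes, j ∈ hull T ∩ hull S} from
      ⟨hT', k, mem_nodes_iff.2 ⟨T, hT, hk⟩, mem_hull hk, mem_hull hk'⟩)

theorem diamRatio_nonneg (d : ℕ) (hκ : 0 ≤ κ) : 0 ≤ diamRatio d κ :=
  pow_nonneg hκ _

theorem ShapeRegular.isPatch_omega0 (h : M.ShapeRegular κ) (hd : 2 ≤ d)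
    (hB : M.BoundaryLocallyConnected) (hT : T ∈ M.simplices) :
    M.IsPatch (diamRatio d κ) T (M.omega0 (hull T)) := by
  intro y hy
  obtain ⟨T', ⟨hT', k, hk, hkT, hkT'⟩, hyT'⟩ := mem_iUnion₂.1 hy
  have hkT := mem_of_mem_hull hk hT hkT
  have hkT' := mem_of_mem_hull hk hT' hkT'
  exact ⟨T', hT', hyT', ⟨k, hkT, hkT'⟩,
    h.diam_le_of_mem_star hd hB (mem_star.2 ⟨hT, hkT⟩) (mem_star.2 ⟨hT', hkT'⟩)⟩

theorem ShapeRegular.eLpNorm_pi2_le_omega0 (h : M.ShapeRegular κ) (hd : 2 ≤ d)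
    (hB : M.BoundaryLocallyConnected) (m : Rd d → Rd d → Rd d) (hv : IntegrableOn v M.domain)
    (hT : T ∈ M.simplices) :
    eLpNorm (M.Pi2 m v) ⊤ (volume.restrict (hull T)) ≤
      ENNReal.ofReal (stabilityConst d κ (diamRatio d κ) * ⨍ x in M.omega0 (hull T), ‖v x‖) := by
  have hQ := diamRatio_nonneg d (h.nonneg hT)
  refine h.eLpNorm_pi2_le (by omega) hv hT hQ (h.isPatch_omega0 hd hB hT)
    fun i j hij hmem => .inr ⟨?_, ?_⟩
  · refine iUnion₂_subset fun S ⟨hS, hi, hj⟩ => ?_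
    exact hmem.elim (fun h => hull_subset_omega0 hT hS h hi) fun h => hull_subset_omega0 hT hS h hj
  · obtain ⟨hne, S, hS, hi, hj⟩ := isEdge_iff.1 hij
    have hdiam : Metric.diam (hull T) ≤ diamRatio d κ * Metric.diam (hull S) := by
      rcases hmem with h' | h'
      · exact h.diam_le_of_mem_star hd hB (mem_star.2 ⟨hS, hi⟩) (mem_star.2 ⟨hT, h'⟩)
      · exact h.diam_le_of_mem_star hd hB (mem_star.2 ⟨hS, hj⟩) (mem_star.2 ⟨hT, h'⟩)
    rw [mul_assoc]
    exact hdiam.trans (mul_le_mul_of_nonneg_left (h.diam_le_mul_norm_sub hS hi hj hne) hQ)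

end NodalPatch

section InteriorEdgePatch

variable {T' : Finset (Rd d)}

theorem hull_subset_omega1 (hT : T ∈ M.simplices) (hT' : T' ∈ M.simplices) (hij : i ≠ j)
    (hi : i ∈ T) (hj : j ∈ T) (hi' : i ∈ T') (hj' : j ∈ T') : hull T' ⊆ M.omega1 (hull T) :=
  subset_biUnion_of_mem (u := hull)
    (show T' ∈ {S ∈ M.simplices | ∃ i j, M.IsEdge i j ∧ segment ℝ i j ⊆ hull T ∩ hull S} from
      ⟨hT', i, j, isEdge_iff.2 ⟨hij, T, hT, hi, hj⟩, subset_inter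
        ((convex_hull T).segment_subset (mem_hull hi) (mem_hull hj))
        ((convex_hull T').segment_subset (mem_hull hi') (mem_hull hj'))⟩)

theorem ShapeRegular.isPatch_omega1 (h : M.ShapeRegular κ) (hT : T ∈ M.simplices) :
    M.IsPatch κ T (M.omega1 (hull T)) := by
  intro y hy
  obtain ⟨T', ⟨hT', i, j, hij, hseg⟩, hyT'⟩ := mem_iUnion₂.1 hy
  obtain ⟨hiT, hiT'⟩ := hseg (left_mem_segment ℝ i j)
  obtain ⟨hjT, hjT'⟩ := hseg (right_mem_segment ℝ i j)
  have hi := mem_of_mem_hull hij.left_mem hT hiT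
  have hj := mem_of_mem_hull hij.right_mem hT hjT
  have hi' := mem_of_mem_hull hij.left_mem hT' hiT'
  have hj' := mem_of_mem_hull hij.right_mem hT' hjT'
  exact ⟨T', hT', hyT', ⟨i, hi, hi'⟩, h.diam_le_of_mem_of_mem hT hT' hij.ne hi hj hi' hj'⟩

theorem psi_eq_zero_of_disjoint_frontier (hT : T ∈ M.simplices)
    (hfrontier : hull T ∩ frontier M.domain = ∅) (hx : x ∈ hull T) (hij : ¬(i ∈ T ∧ j ∈ T)) :
    M.psi m i j x = 0 := by
  by_cases hbd : M.IsBoundaryEdge i j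
  · have hnotMem (k : Rd d) (hk : k ∈ segment ℝ i j) : k ∉ T := fun hkT =>
      (hfrontier.subset ⟨mem_hull hkT, hbd.2 hk⟩).elim
    exact psi_eq_zero hT hx (hnotMem i (left_mem_segment ℝ i j))
      (hnotMem j (right_mem_segment ℝ i j))
  · rw [psi, if_neg hbd]
    exact b_eq_zero hT hx hij

theorem ShapeRegular.eLpNorm_pi2_le_omega1 (h : M.ShapeRegular κ) (hd : 1 ≤ d)
    (m : Rd d → Rd d → Rd d) (hv : IntegrableOn v M.domain) (hT : T ∈ M.simplices)
    (hfrontier : hull T ∩ frontier M.domain = ∅) :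
    eLpNorm (M.Pi2 m v) ⊤ (volume.restrict (hull T)) ≤
      ENNReal.ofReal (stabilityConst d κ κ * ⨍ x in M.omega1 (hull T), ‖v x‖) := by
  refine h.eLpNorm_pi2_le hd hv hT (h.nonneg hT) (h.isPatch_omega1 hT) fun i j hij _ => ?_
  by_cases hmem : i ∈ T ∧ j ∈ T
  · refine .inr ⟨iUnion₂_subset fun S ⟨hS, hi, hj⟩ =>
      hull_subset_omega1 hT hS hij.ne hmem.1 hmem.2 hi hj, ?_⟩
    refine (h.diam_le_mul_norm_sub hT hmem.1 hmem.2 hij.ne).trans ?_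
    gcongr
    exact le_mul_of_one_le_left (h.nonneg hT) (h.one_le hT hd)
  · exact .inl fun x hx => psi_eq_zero_of_disjoint_frontier hT hfrontier hx (mt And.symm hmem)

end InteriorEdgePatch

end Mesh

end Fortin

end

theorem mainTheorem4_general (d : ℕ) (hd : 1 ≤ d) :
    (∀ M : Fortin.Mesh d, (M.HasInteriorNodes → ∃ m, M.IsChoice m) ∧
      ∀ m, M.IsChoice m →
        (∀ v, IntegrableOn v M.domain → M.Pi2 m v ∈ M.edgeSpace) ∧
        (∀ v w, IntegrableOn v M.domain → IntegrableOn w M.domain →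
          v =ᵐ[volume.restrict M.domain] w → M.Pi2 m v = M.Pi2 m w) ∧
        (∀ v w, IntegrableOn v M.domain → IntegrableOn w M.domain →
          M.Pi2 m (v + w) = M.Pi2 m v + M.Pi2 m w) ∧
        (∀ (c : ℝ) (v), IntegrableOn v M.domain → M.Pi2 m (c • v) = c • M.Pi2 m v) ∧
        (∀ v G, Fortin.MemW110 M.domain v G →
          ∃ H, Fortin.MemW11 M.domain (M.Pi2 m v) H ∧
            ∀ k ∈ M.nodes, ∫ x in M.domain, Fortin.divOf H x * M.phi k x =
              ∫ x in M.domain, Fortin.divOf G x * M.phi k x)) ∧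
    (∀ κ : ℝ, ∃ C : ℝ, 0 < C ∧
      ∀ M : Fortin.Mesh d, M.ShapeRegular κ →
      ∀ m, M.IsChoice m → ∀ v, IntegrableOn v M.domain → ∀ T ∈ M.simplices,
        (2 ≤ d → M.BoundaryLocallyConnected →
          eLpNorm (M.Pi2 m v) ∞ (volume.restrict (Fortin.Mesh.hull T)) ≤
            ENNReal.ofReal (C * ⨍ x in M.omega0 (Fortin.Mesh.hull T), ‖v x‖)) ∧
        (Fortin.Mesh.hull T ∩ frontier M.domain = ∅ →
          eLpNorm (M.Pi2 m v) ∞ (volume.restrict (Fortin.Mesh.hull T)) ≤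
            ENNReal.ofReal (C * ⨍ x in M.omega1 (Fortin.Mesh.hull T), ‖v x‖))) := by
  refine ⟨fun M => ⟨Fortin.Mesh.exists_isChoice, fun m hm => ⟨fun v _ =>
      Fortin.Mesh.pi2_mem_edgeSpace hm v, fun v w _ _ => Fortin.Mesh.pi2_congr_ae m,
      fun v w => Fortin.Mesh.pi2_add m, fun c v _ => Fortin.Mesh.pi2_smul m c v,
      fun v G => Fortin.Mesh.exists_memW11_pi2 hm⟩⟩, fun κ => ?_⟩
  let C₀ := Fortin.Mesh.stabilityConst d κ (Fortin.Mesh.diamRatio d κ)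
  let C₁ := Fortin.Mesh.stabilityConst d κ κ
  refine ⟨max 1 (max C₀ C₁), zero_lt_one.trans_le (le_max_left _ _),
    fun M hκ m _ v hv T hT => ⟨fun hd' hB => ?_, fun hfrontier => ?_⟩⟩
  · refine (hκ.eLpNorm_pi2_le_omega0 hd' hB m hv hT).trans (ENNReal.ofReal_le_ofReal ?_)
    exact mul_le_mul_of_nonneg_right ((le_max_left C₀ C₁).trans (le_max_right _ _))
      (integral_nonneg fun _ => norm_nonneg _)
  · refine (hκ.eLpNorm_pi2_le_omega1 hd m hv hT hfrontier).trans (ENNReal.ofReal_le_ofReal ?_)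
    exact mul_le_mul_of_nonneg_right ((le_max_right C₀ C₁).trans (le_max_right _ _))
      (integral_nonneg fun _ => norm_nonneg _)

theorem mainTheorem4 (d : ℕ) (hd : 2 ≤ d) :
    -- the operator is well defined and linear on `L¹`, has values in the span of the interior
    -- tangential bubbles, and preserves the discrete divergence
    (∀ M : Fortin.Mesh d, M.HasInteriorNodes →
      (∃ m, M.IsChoice m) ∧
      ∀ m, M.IsChoice m →
        (∀ v, IntegrableOn v M.domain → M.Pi2 m v ∈ M.edgeSpace) ∧
        (∀ v w, IntegrableOn v M.domain → IntegrableOn w M.domain →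
          v =ᵐ[volume.restrict M.domain] w → M.Pi2 m v = M.Pi2 m w) ∧
        (∀ v w, IntegrableOn v M.domain → IntegrableOn w M.domain →
          M.Pi2 m (v + w) = M.Pi2 m v + M.Pi2 m w) ∧
        (∀ (c : ℝ) (v), IntegrableOn v M.domain → M.Pi2 m (c • v) = c • M.Pi2 m v) ∧
        (∀ v G, Fortin.MemW110 M.domain v G →
          ∃ H, Fortin.MemW11 M.domain (M.Pi2 m v) H ∧
            ∀ k ∈ M.nodes, ∫ x in M.domain, Fortin.divOf H x * M.phi k x =
              ∫ x in M.domain, Fortin.divOf G x * M.phi k x)) ∧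
    -- local stability, with a constant that depends only on `d` and the shape regularity
    (∀ κ : ℝ, ∃ C : ℝ, 0 < C ∧
      ∀ M : Fortin.Mesh d, M.HasInteriorNodes → M.ShapeRegular κ →
      ∀ m, M.IsChoice m → ∀ v, IntegrableOn v M.domain → ∀ T ∈ M.simplices,
        (M.BoundaryLocallyConnected →
          eLpNorm (M.Pi2 m v) ∞ (volume.restrict (Fortin.Mesh.hull T)) ≤
            ENNReal.ofReal (C * ⨍ x in M.omega0 (Fortin.Mesh.hull T), ‖v x‖)) ∧
        (Fortin.Mesh.hull T ∩ frontier M.domain = ∅ →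
          eLpNorm (M.Pi2 m v) ∞ (volume.restrict (Fortin.Mesh.hull T)) ≤
            ENNReal.ofReal (C * ⨍ x in M.omega1 (Fortin.Mesh.hull T), ‖v x‖))) := by
  obtain ⟨hoperator, hstability⟩ := mainTheorem4_general d (by omega)
  refine ⟨fun M hM => ⟨(hoperator M).1 hM, (hoperator M).2⟩, fun κ => ?_⟩
  obtain ⟨C, hC, hbound⟩ := hstability κ
  exact ⟨C, hC, fun M _ hκ m hm v hv T hT => (hbound M hκ m hm v hv T hT).imp_left (· hd)⟩
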